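/- Let $n\ge 2$, $N, k\ge 0$ be integers, and let $B_n$ be the open unit ball of $\mathbf C^n$. A function $R$ on $B_n$ is a *squared norm* if $R=\|g\|^2$ on $B_n$ for some holomorphic map $g$ from $B_n$ to a Hilbert space. Let $f_1,\dots,f_{k+1}$, $f_j:B_n\to B_{N_j}$, be proper holomorphic maps whose squared norms $\|f_j\|^2$ are linearly independent over $\mathbf R$; for $\lambda\in\mathbf R^k$ put $$R_\lambda=\sum_{j=1}^k\lambda_j\|f_j\|^2+\Big(1-\sum_{j=1}^k\lambda_j\Big)\|f_{k+1}\|^2 ,$$ and let $K$ be the (automatically convex) set of those $\lambda\in\mathbf R^k$ for which $R_\lambda$ is a squared norm. The *$k$-dimensional convex family* $\mathcal F$ determined by $f_1,\dots,f_{k+1}$ consists of all proper holomorphic maps $f$ from $B_n$ to some ball $B_M$ such that $\|f\|^2=R_\lambda$ on $B_n$ for some $\lambda\in K$. Suppose that $\mathcal F$ is a family of monomial maps from $B_n$ to $B_N$, in the sense that for every $f\in\mathcal F$ there is a proper holomorphic map $g:B_n\to B_N$, each of whose components is a monomial $c\,z^\alpha$ (possibly with $c=0$), such that $\|f\|^2=\|g\|^2$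 on $B_n$. Then every $f\in\mathcal F$ is a polynomial map, and its degree satisfies $$\deg(f)\le \frac43\cdot\frac{2(N-k)-3}{2n-3}.$$ -/

import Mathlib

namespace BallMaps

/-- Complex Euclidean space `ℂⁿ` with its Hermitian norm. -/
abbrev Cn (n : ℕ) : Type := EuclideanSpace ℂ (Fin n)

/-- The open unit ball `B_n` of `ℂⁿ`. -/
abbrev B (n : ℕ) : Set (Cn n) := Metric.ball 0 1

/-- `f` restricts to a proper holomorphic map from `B_n` to `B_N`
(the values of `f` outside `B_n` play no role). -/
structure IsProperHolomorphic {n N : ℕ} (f : Cn n → Cn N) : Prop where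
  holomorphic : DifferentiableOn ℂ f (B n)
  mapsTo : Set.MapsTo f (B n) (B N)
  proper : IsProperMap (mapsTo.restrict f (B n) (B N))

/-- Two maps from `B_n` to possibly different balls are norm equivalent when their squared
norms are the same function on `B_n`. -/
def NormEquivalent {n N M : ℕ} (f : Cn n → Cn N) (g : Cn n → Cn M) : Prop :=
  ∀ z ∈ B n, ‖f z‖ ^ 2 = ‖g z‖ ^ 2

/-- Every component of `f` is a monomial `c z^α` (the coefficient may be zero). -/
def IsMonomialMap {n N : ℕ} (f : Cn n → Cn N) : Prop :=
  ∀ i : Fin N, ∃ (α : Fin n → ℕ) (c : ℂ), ∀ z ∈ B n, f z i = c * ∏ j, z j ^ α j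

/-- On `B_n` the map `f` is polynomial, of degree `d`: the largest total degree of a component. -/
def HasDegree {n N : ℕ} (f : Cn n → Cn N) (d : ℕ) : Prop :=
  ∃ P : Fin N → MvPolynomial (Fin n) ℂ,
    (∀ z ∈ B n, ∀ i, f z i = MvPolynomial.eval (fun j => z j) (P i)) ∧
      Finset.univ.sup (fun i => (P i).totalDegree) = d

/-- The class `𝒫_∞`: functions on `B_n` that are the squared norm of a holomorphic function with
values in a Hilbert space. -/
def IsSquaredNorm {n : ℕ} (R : Cn n → ℝ) : Prop :=
  ∃ (H : Type) (_ : NormedAddCommGroup H) (_ : InnerProductSpace ℂ H) (_ : CompleteSpace H)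
    (g : Cn n → H), DifferentiableOn ℂ g (B n) ∧ ∀ z ∈ B n, R z = ‖g z‖ ^ 2

/-- The data generating a `k`-dimensional convex family of proper maps from `B_n`: `k + 1` proper
maps, with possibly different target balls, whose squared norms on `B_n` are linearly
independent. -/
structure ConvexFamily (n k : ℕ) where
  targetDim : Fin (k + 1) → ℕ
  gen : ∀ j, Cn n → Cn (targetDim j)
  proper : ∀ j, IsProperHolomorphic (gen j)
  linearIndependent : LinearIndependent ℝ (fun j => fun z : B n => ‖gen j z‖ ^ 2)

namespace ConvexFamily

variable {n k : ℕ} (F : ConvexFamily n k)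

/-- `R_t = ∑_{j ≤ k} t_j ‖f_j‖² + (1 - ∑_j t_j) ‖f_{k+1}‖²`, for `t ∈ ℝᵏ`. -/
noncomputable def R (t : Fin k → ℝ) (z : Cn n) : ℝ :=
  ∑ j : Fin k, t j * ‖F.gen j.castSucc z‖ ^ 2 +
    (1 - ∑ j : Fin k, t j) * ‖F.gen (Fin.last k) z‖ ^ 2

/-- The parameter set: all `t ∈ ℝᵏ` with `R_t ∈ 𝒫_∞`. By `isGreatest_K` it is the largest convex
set on which `R_t ∈ 𝒫_∞`. -/
def K : Set (Fin k → ℝ) := {t | IsSquaredNorm (F.R t)}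

theorem isGreatest_K :
    IsGreatest {C : Set (Fin k → ℝ) | Convex ℝ C ∧ ∀ t ∈ C, IsSquaredNorm (F.R t)} F.K := by
  refine ⟨⟨?_, fun t ht => ht⟩, fun C hC t ht => hC.2 t ht⟩
  rintro s ⟨H, _, _, _, g, hg, hgR⟩ t ⟨H', _, _, _, g', hg', hgR'⟩ a b ha hb hab
  refine ⟨WithLp 2 (H × H'), inferInstance, inferInstance, inferInstance,
    fun z => WithLp.toLp 2 ((Real.sqrt a : ℂ) • g z, (Real.sqrt b : ℂ) • g' z), ?_, ?_⟩
  · exact (WithLp.prodContinuousLinearEquiv 2 ℂ H H').symm.differentiable.comp_differentiableOn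
      ((hg.const_smul _).prodMk (hg'.const_smul _))
  · intro z hz
    have h1 : F.R (a • s + b • t) z = a * F.R s z + b * F.R t z := by
      have h2 : a * F.R s z + b * F.R t z = a * F.R s z + b * F.R t z
          + (1 - (a + b)) * ‖F.gen (Fin.last k) z‖ ^ 2 := by rw [hab]; ring
      rw [h2]
      simp only [R, Pi.add_apply, Pi.smul_apply, smul_eq_mul, add_mul, Finset.sum_add_distrib,
        mul_assoc, ← Finset.mul_sum]
      ring
    rw [h1, hgR z hz, hgR' z hz, WithLp.prod_norm_sq_eq_of_L2]
    simp [norm_smul, mul_pow, abs_of_nonneg, Real.sq_sqrt ha, Real.sq_sqrt hb]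

/-- `f : B_n → B_N` is a member of the family: `f` is proper and `‖f‖² = R_t` for some `t ∈ K`. -/
def Mem {N : ℕ} (f : Cn n → Cn N) : Prop :=
  IsProperHolomorphic f ∧ ∃ t ∈ F.K, ∀ z ∈ B n, ‖f z‖ ^ 2 = F.R t z

/-- The family consists, up to norm equivalence, of monomial proper maps from `B_n` to `B_N`. -/
def IsMonomialInto (N : ℕ) : Prop :=
  ∀ (M : ℕ) (f : Cn n → Cn M), F.Mem f →
    ∃ g : Cn n → Cn N, IsProperHolomorphic g ∧ IsMonomialMap g ∧ NormEquivalent f g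

end ConvexFamily

end BallMaps

/-!
The theorem holds with the constant `1` in place of `4 / 3`, and for the following reason.

**Polynomials on a hyperplane.** The squared norm of a monomial map is a polynomial `p` with
nonnegative coefficients in the variables `xᵢ = |zᵢ|²`, with one term for each monomial of the map,
and properness says that `p = 1` on the hyperplane `∑ xᵢ = 1`, i.e. `1 - p = (1 - ∑ xᵢ) q`. The core
is the bound `(2n - 3) d + 3 ≤ 2N` for such a `p` with `d = deg p ≥ 1` and `N` terms
(`IsHyperplanePair.degree_bound`). Compare degrees: the part of `q` of degree `j + 1` is `∑ xᵢ` times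
the part of degree `j`, minus the part of `p` of degree `j + 1`. So `q` evolves from a constant
to `0` in `d` steps, and the terms of `p` are what has to be subtracted on the way.

* For `n = 2` the parts of `q` are sequences, and a step is multiplication by `1 + X` followed by
  subtraction of the terms of `p`. By Descartes' rule of signs (`AltChain.sub_shift`) the
  multiplication gains one alternation of `(-1)ᵗ aₜ`; a subtracted term destroys at most two, and at
  most one at an end of the sequence (`altLen_step`); and ending at `0` costs one term for each
  alternation and one more. This gives `d + 3 ≤ 2N` (`add_numDeaths_le_card_of_edge`).
* In more variables the same analysis applies to two-dimensional faces of the Newton polytopes of the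
  parts of `q`, selected by lexicographic weights. Such a face may die and be replaced by another one,
  which is why the deaths are counted along. A vertex of a part of `q` never carries a negative
  coefficient, as this would reproduce itself for ever (`coeff_nonneg_of_vertex`).
* The number of variables is raised one at a time (`add_numDeaths_le_card`). The face of the terms
  with the least exponent of a variable `k`, the floor, is covered by induction. Off the floor there
  is at least one more term for each step (`le_card_off_floor`): two rows climb from the floor in the
  direction `k` and meet in a common corner, which is an end of both, so that the alternations they
  gain have to be paid by terms of which each is seen at most twice.

**Families.** In a family of dimension `k` the generators and their barycenter are members, so all
the polynomials of the family live on the support of that of the barycenter, which has at most `N`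
elements. Moving to a vertex of the polytope of parameters with nonnegative coefficients, while
keeping a term of top degree of the given member, makes `k` of these terms vanish (`exists_sparse`),
so that `N` may be replaced by `N - k` (`family_degree_bound`).

**From norms to maps.** It remains to see that a holomorphic map `f` with the norm of a monomial map
`g` is polynomial of no larger degree (`exists_hasDegree_le`). On a complex line the Laplacian of
`‖f‖²` is `4 ‖f'‖²`, so equality of norms passes to derivatives; hence `f` is polynomial on lines
along with `g` (`exists_poly_of_norm_eq`). Lines parallel to the axes show that `f` is polynomial near
`0`, and lines through the origin bound the degree and extend this to the ball.
-/

/-! ### Alternating chains in real sequences -/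

namespace BallMaps

/-- `AltChain c l` says that the sequence `c` has `l` entries, at increasing positions, whose signs
alternate strictly. The first sign is that of `ε`. -/
def AltChain (c : ℕ → ℝ) (l : ℕ) : Prop :=
  ∃ (k : ℕ → ℕ) (ε : ℝ), (∀ i, i + 1 < l → k i < k (i + 1)) ∧
    ∀ i < l, 0 < ε * (-1) ^ i * c (k i)

theorem altChain_zero (c : ℕ → ℝ) : AltChain c 0 := ⟨id, 1, by simp, by simp⟩

theorem altChain_one {c : ℕ → ℝ} {t : ℕ} (h : c t ≠ 0) : AltChain c 1 := by
  refine ⟨fun _ => t, c t, by simp, fun i hi => ?_⟩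
  obtain rfl : i = 0 := by omega
  simpa using mul_self_pos.2 h

theorem AltChain.mono {c : ℕ → ℝ} {l m : ℕ} (h : AltChain c l) (hm : m ≤ l) : AltChain c m := by
  obtain ⟨k, ε, h1, h2⟩ := h
  exact ⟨k, ε, fun i hi => h1 i (by omega), fun i hi => h2 i (by omega)⟩

theorem chain_lt {k : ℕ → ℕ} {l : ℕ} (h : ∀ i, i + 1 < l → k i < k (i + 1)) {i j : ℕ}
    (hij : i < j) (hj : j < l) : k i < k j := by
  induction j, hij using Nat.le_induction with
  | base => exact h i hj
  | succ j hij ih => exact (ih (by omega)).trans (h j hj)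

theorem AltChain.le_card {c : ℕ → ℝ} {l : ℕ} (h : AltChain c l) {V : Finset ℕ}
    (hV : ∀ t, c t ≠ 0 → t ∈ V) : l ≤ V.card := by
  obtain ⟨k, ε, h1, h2⟩ := h
  rw [← Finset.card_range l]
  refine Finset.card_le_card_of_injOn k (fun i hi => hV _ fun h0 => ?_) fun i hi j hj hij => ?_
  · simpa [h0] using h2 i (by simpa using hi)
  · simp only [Finset.coe_range, Set.mem_Iio] at hi hj
    rcases lt_trichotomy i j with h | h | h
    · exact absurd hij (chain_lt h1 h hj).ne
    · exact h
    · exact absurd hij (chain_lt h1 h hi).ne'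

theorem exists_pos_increment {δ : ℝ} {F : ℕ → ℝ} {a b : ℕ} (hab : a ≤ b)
    (h : 0 < δ * (F b - F a)) : ∃ t, a ≤ t ∧ t < b ∧ 0 < δ * (F (t + 1) - F t) := by
  by_contra! hc
  have key : ∀ b, a ≤ b → (∀ t, a ≤ t → t < b → δ * (F (t + 1) - F t) ≤ 0) →
      δ * (F b - F a) ≤ 0 := by
    intro b hab
    induction b, hab using Nat.le_induction with
    | base => simp
    | succ b hab ih =>
      intro hh
      have h1 := ih fun t h1 h2 => hh t h1 (by omega)
      have h2 := hh b hab (by omega)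
      linarith
  exact absurd h (not_lt.2 (key b hab hc))

/-- Descartes' rule of signs for multiplication by `1 - X`: passing to the differences of a finitely
supported sequence lengthens its longest alternating chain. Between two consecutive entries of the
chain, and before the first and after the last, some difference has the required sign. -/
theorem AltChain.sub_shift {c : ℕ → ℝ} {l B : ℕ} (hB : ∀ t, c t ≠ 0 → t < B)
    (h : AltChain c (l + 1)) :
    AltChain (fun t => c t - if t = 0 then 0 else c (t - 1)) (l + 2) := by
  obtain ⟨k, ε, h1, h2⟩ := h
  -- `F` is `c` shifted by one place, so that the differences start from `F 0 = 0`.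
  set F : ℕ → ℝ := fun t => if t = 0 then 0 else c (t - 1) with hF
  -- The breakpoints: `0`, the chain, and a place beyond the support.
  set K : ℕ → ℕ := fun i => if i = 0 then 0 else if i ≤ l + 1 then k (i - 1) + 1 else k l + B + 2
    with hK
  have hKm : ∀ i < l + 2, K i < K (i + 1) := by
    intro i hi
    rcases Nat.eq_zero_or_pos i with rfl | hi0
    · simp [hK]
    · rcases Nat.lt_or_ge i (l + 1) with h3 | h3
      · have := h1 (i - 1) (by omega)
        rw [Nat.sub_add_cancel hi0] at this
        simp [hK, show i ≠ 0 by omega, show i ≤ l + 1 by omega, show i ≤ l by omega, this]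
      · obtain rfl : i = l + 1 := by omega
        simp only [hK]
        simp
  have hKs : ∀ i < l + 2, ∃ t, K i ≤ t ∧ t < K (i + 1) ∧ 0 < ε * (-1) ^ i * (F (t + 1) - F t) := by
    intro i hi
    refine exists_pos_increment (hKm i hi).le ?_
    have ha : i = 0 ∧ F (K i) = 0 ∨ 0 < i ∧ 0 < ε * (-1) ^ (i + 1) * F (K i) := by
      rcases Nat.eq_zero_or_pos i with rfl | hi0
      · exact Or.inl ⟨rfl, by simp [hK, hF]⟩
      · refine Or.inr ⟨hi0, ?_⟩
        have := h2 (i - 1) (by omega)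
        obtain ⟨i, rfl⟩ : ∃ i', i = i' + 1 := ⟨i - 1, by omega⟩
        simp only [Nat.add_sub_cancel] at this
        simpa [hK, hF, show i ≤ l by omega, pow_succ] using this
    have hb : i = l + 1 ∧ F (K (i + 1)) = 0 ∨ i < l + 1 ∧ 0 < ε * (-1) ^ i * F (K (i + 1)) := by
      rcases Nat.lt_or_ge i (l + 1) with h3 | h3
      · exact Or.inr ⟨h3, by simpa [hK, hF, show i ≤ l by omega] using h2 i h3⟩
      · refine Or.inl ⟨by omega, ?_⟩
        obtain rfl : i = l + 1 := by omega
        have : c (k l + B + 2 - 1) = 0 := by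
          by_contra h0
          have := hB _ h0
          omega
        simp only [hF, hK]
        simpa using this
    rw [pow_succ] at ha
    rw [mul_sub]
    rcases ha with ⟨ha, ha'⟩ | ⟨ha, ha'⟩ <;> rcases hb with ⟨hb, hb'⟩ | ⟨hb, hb'⟩
    · omega
    · rw [ha']; linarith
    · rw [hb']; linarith
    · linarith
  choose! m hm1 hm2 hm3 using hKs
  refine ⟨m, ε, fun i hi => ?_, fun i hi => ?_⟩
  · exact (hm2 i (by omega)).trans_le (hm1 (i + 1) (by omega))
  · simpa [hF] using hm3 i hi

theorem AltChain.change_one {c c' : ℕ → ℝ} {l t : ℕ} (h : AltChain c l)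
    (hc : ∀ s, s ≠ t → c' s = c s) : AltChain c' (l - 2) := by
  obtain ⟨k, ε, h1, h2⟩ := h
  by_cases hex : ∃ i, i < l - 2 ∧ k i = t
  · obtain ⟨i₀, hi₀, hk⟩ := hex
    refine ⟨fun j => if j < i₀ then k j else k (j + 2), ε, fun i hi => ?_, fun i hi => ?_⟩
    · by_cases h3 : i + 1 < i₀
      · simpa [h3, show i < i₀ by omega] using h1 i (by omega)
      · by_cases h4 : i < i₀
        · simpa [h3, h4] using chain_lt h1 (show i < i + 1 + 2 by omega) (by omega)
        · simpa [h3, h4] using h1 (i + 2) (by omega)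
    · by_cases h4 : i < i₀
      · have h5 : k i < k i₀ := chain_lt h1 h4 (by omega)
        simpa [h4, hc (k i) (by omega)] using h2 i (by omega)
      · have h5 : k i₀ < k (i + 2) := chain_lt h1 (by omega) (by omega)
        simpa [h4, hc (k (i + 2)) (by omega), pow_add] using h2 (i + 2) (by omega)
  · push Not at hex
    refine ⟨k, ε, fun i hi => h1 i (by omega), fun i hi => ?_⟩
    rw [hc _ (hex i hi)]
    exact h2 i (by omega)

theorem AltChain.change_top {c c' : ℕ → ℝ} {l t : ℕ} (h : AltChain c l)
    (hc : ∀ s, s ≠ t → c' s = c s) (ht : ∀ s, c s ≠ 0 → s ≤ t) : AltChain c' (l - 1) := by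
  obtain ⟨k, ε, h1, h2⟩ := h
  refine ⟨k, ε, fun i hi => h1 i (by omega), fun i hi => ?_⟩
  have h3 : k (i + 1) ≤ t := ht _ fun h0 => by simpa [h0] using h2 (i + 1) (by omega)
  have h4 := h1 i (by omega)
  rw [hc _ (by omega)]
  exact h2 i (by omega)

theorem AltChain.change_bot {c c' : ℕ → ℝ} {l t : ℕ} (h : AltChain c l)
    (hc : ∀ s, s ≠ t → c' s = c s) (ht : ∀ s, c s ≠ 0 → t ≤ s) : AltChain c' (l - 1) := by
  obtain ⟨k, ε, h1, h2⟩ := h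
  refine ⟨fun i => k (i + 1), -ε, fun i hi => h1 (i + 1) (by omega), fun i hi => ?_⟩
  have h3 : t ≤ k i := ht _ fun h0 => by simpa [h0] using h2 i (by omega)
  have h4 := h1 i (by omega)
  have h5 := h2 (i + 1) (by omega)
  rw [pow_succ] at h5
  change 0 < -ε * (-1) ^ i * c' (k (i + 1))
  rw [hc _ (by omega)]
  linarith

theorem AltChain.change_same_sign {c c' : ℕ → ℝ} {l t : ℕ} (h : AltChain c l)
    (hc : ∀ s, s ≠ t → c' s = c s) (ht : 0 < c t * c' t) : AltChain c' l := by
  obtain ⟨k, ε, h1, h2⟩ := h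
  refine ⟨k, ε, h1, fun i hi => ?_⟩
  have h3 := h2 i hi
  by_cases hk : k i = t
  · rw [hk] at h3 ⊢
    by_contra! h4
    have h5 : 0 < (ε * (-1) ^ i * c t) * (ε * (-1) ^ i * c' t) := by
      have : ε * (-1) ^ i ≠ 0 := fun h0 => by simp [h0] at h3
      have := mul_pos (mul_self_pos.2 this) ht
      linarith
    exact absurd h5 (not_lt.2 (mul_nonpos_of_nonneg_of_nonpos h3.le h4))
  · rwa [hc _ hk]

theorem AltChain.change_finset (W : Finset ℕ) {c c' : ℕ → ℝ} {l : ℕ} (h : AltChain c l)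
    (hc : ∀ s, s ∉ W → c' s = c s) : AltChain c' (l - 2 * W.card) := by
  induction W using Finset.induction_on generalizing c' with
  | empty => exact (funext fun s => hc s (by simp) : c' = c) ▸ h
  | insert t W ht ih =>
    have h1 := ih (c' := fun s => if s = t then c s else c' s) fun s hs => by
      by_cases hst : s = t
      · simp [hst]
      · simp [hst, hc s (by simp [hst, hs])]
    have h2 := h1.change_one (c' := c') (t := t) fun s hs => by simp [hs]
    rw [Finset.card_insert_of_notMem ht]
    exact h2.mono (by omega)

/-- The sequence `(-1)^t a_t`. It turns multiplication by `1 + X` into multiplication by `1 - X`. -/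
def twist (a : ℕ → ℝ) (t : ℕ) : ℝ := (-1) ^ t * a t

theorem twist_ne_zero {a : ℕ → ℝ} {t : ℕ} : twist a t ≠ 0 ↔ a t ≠ 0 := by simp [twist]

/-- The length of the longest alternating chain of `(-1)^t a_t`. -/
noncomputable def altLen (a : ℕ → ℝ) : ℕ := sSup {l | AltChain (twist a) l}

theorem altLen_bddAbove {a : ℕ → ℝ} {V : Finset ℕ} (hV : ∀ t, a t ≠ 0 → t ∈ V) :
    BddAbove {l | AltChain (twist a) l} :=
  ⟨V.card, fun _ hl => AltChain.le_card hl fun t ht => hV t (twist_ne_zero.1 ht)⟩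

theorem altChain_altLen {a : ℕ → ℝ} {V : Finset ℕ} (hV : ∀ t, a t ≠ 0 → t ∈ V) :
    AltChain (twist a) (altLen a) :=
  Nat.sSup_mem ⟨0, altChain_zero _⟩ (altLen_bddAbove hV)

theorem AltChain.le_altLen {a : ℕ → ℝ} {V : Finset ℕ} (hV : ∀ t, a t ≠ 0 → t ∈ V) {l : ℕ}
    (h : AltChain (twist a) l) : l ≤ altLen a := le_csSup (altLen_bddAbove hV) h

theorem one_le_altLen {a : ℕ → ℝ} {V : Finset ℕ} (hV : ∀ t, a t ≠ 0 → t ∈ V) {t : ℕ}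
    (ht : a t ≠ 0) : 1 ≤ altLen a :=
  AltChain.le_altLen hV (altChain_one (twist_ne_zero.2 ht))

section RowStep

variable {a v g : ℕ → ℝ} {b τ : ℕ}

theorem altChain_add_shift
    (ha : ∀ t, a t ≠ 0 → b ≤ t ∧ t < τ) (ha0 : ∃ t, a t ≠ 0)
    (hrec : ∀ t, g t + v t = a t + if t = 0 then 0 else a (t - 1)) :
    AltChain (twist fun t => g t + v t) (altLen a + 1) := by
  have hV : ∀ t, a t ≠ 0 → t ∈ Finset.range τ := fun t ht => by simpa using (ha t ht).2
  obtain ⟨t, ht⟩ := ha0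
  obtain ⟨l, hl⟩ : ∃ l, altLen a = l + 1 := ⟨altLen a - 1, by have := one_le_altLen hV ht; omega⟩
  have h := altChain_altLen hV
  rw [hl] at h ⊢
  have h2 := h.sub_shift (B := τ) fun t ht => (ha t (twist_ne_zero.1 ht)).2
  convert h2 using 1
  funext t
  rw [twist, hrec]
  rcases t with _ | t
  · simp [twist]
  · simp [twist, pow_succ]; ring

theorem altLen_add_one_le_card
    (ha : ∀ t, a t ≠ 0 → b ≤ t ∧ t < τ) (ha0 : ∃ t, a t ≠ 0)
    (hrec : ∀ t, g t + v t = a t + if t = 0 then 0 else a (t - 1)) (hg : ∀ t, g t = 0)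
    {V : Finset ℕ} (hV : ∀ t, t ∈ V ↔ v t ≠ 0) : altLen a + 1 ≤ V.card := by
  refine (altChain_add_shift ha ha0 hrec).le_card fun t ht => (hV t).2 ?_
  simpa [hg] using twist_ne_zero.1 ht

/-- One step `a ↦ g = (1 + X) a - v` of the row dynamics, where everything is supported in `[b, τ]`:
the multiplication gains one sign alternation, and subtracting `v` loses at most two for each entry
of `v`, at most one for the top entry, and at most one for the bottom entry, and then only if `v`
kills it. -/
theorem altLen_step
    (ha : ∀ t, a t ≠ 0 → b ≤ t ∧ t < τ) (ha0 : ∃ t, a t ≠ 0)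
    (hrec : ∀ t, g t + v t = a t + if t = 0 then 0 else a (t - 1))
    (hv : ∀ t, 0 ≤ v t) (hg : ∀ t, g t ≠ 0 → b ≤ t ∧ t ≤ τ)
    (hgb : 0 ≤ g b) {V : Finset ℕ} (hV : ∀ t, t ∈ V ↔ v t ≠ 0) :
    altLen a + 1 ≤ altLen g + 2 * (V \ {b, τ}).card + (if τ ∈ V then 1 else 0) +
      (if b ∈ V ∧ g b = 0 then 1 else 0) := by
  classical
  have hbτ : b < τ := by
    obtain ⟨t, ht⟩ := ha0
    have := ha t ht
    omega
  have hgV : ∀ t, g t ≠ 0 → t ∈ Finset.range (τ + 1) := fun t ht => by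
    have := hg t ht
    simp; omega
  have h0 := altChain_add_shift ha ha0 hrec
  set f : ℕ → ℝ := fun t => g t + v t with hf
  have hfs : ∀ t, f t ≠ 0 → b ≤ t ∧ t ≤ τ := by
    intro t ht
    rw [hf] at ht
    simp only [hrec] at ht
    by_cases h1 : a t = 0
    · rw [h1, zero_add] at ht
      split_ifs at ht with h2
      · simp at ht
      · have := ha _ ht
        omega
    · have := ha _ h1
      omega
  -- First subtract the interior entries of `v`, then the top one, then the bottom one.
  set f₁ : ℕ → ℝ := fun t => if t = b ∨ t = τ then f t else g t with hf₁
  set f₂ : ℕ → ℝ := fun t => if t = b then f t else g t with hf₂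
  have hs₁ : ∀ t, f₁ t ≠ 0 → b ≤ t ∧ t ≤ τ := by
    intro t ht
    simp only [hf₁] at ht
    split_ifs at ht
    exacts [hfs t ht, hg t ht]
  have hs₂ : ∀ t, f₂ t ≠ 0 → b ≤ t ∧ t ≤ τ := by
    intro t ht
    simp only [hf₂] at ht
    split_ifs at ht
    exacts [hfs t ht, hg t ht]
  have h1 : AltChain (twist f₁) (altLen a + 1 - 2 * (V \ {b, τ}).card) := by
    refine h0.change_finset _ fun s hs => ?_
    simp only [twist, hf₁]
    split_ifs with h3
    · rfl
    · have : v s = 0 := by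
        by_contra h4
        exact hs (by simp [hV, h4, not_or.1 h3])
      simp [hf, this]
  have h2 : AltChain (twist f₂)
      (altLen a + 1 - 2 * (V \ {b, τ}).card - (if τ ∈ V then 1 else 0)) := by
    split_ifs with hτ
    · refine h1.change_top (t := τ) (fun s hs => ?_) fun s hs => (hs₁ s (twist_ne_zero.1 hs)).2
      simp [twist, hf₁, hf₂, hs]
    · refine (funext fun s => ?_ : twist f₂ = twist f₁) ▸ h1
      rcases eq_or_ne s τ with rfl | hs
      · have : v s = 0 := by
          by_contra h4
          exact hτ ((hV _).2 h4)
        simp [twist, hf₁, hf₂, hf, this]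
      · simp [twist, hf₁, hf₂, hs]
  generalize (if τ ∈ V then 1 else 0) = e at h2 ⊢
  have h3 : AltChain (twist g)
      (altLen a + 1 - 2 * (V \ {b, τ}).card - e -
      (if b ∈ V ∧ g b = 0 then 1 else 0)) := by
    have hne : ∀ s, s ≠ b → twist g s = twist f₂ s := fun s hs => by simp [twist, hf₂, hs]
    by_cases hbV : b ∈ V
    · by_cases hg0 : g b = 0
      · rw [if_pos ⟨hbV, hg0⟩]
        exact h2.change_bot (t := b) hne fun s hs => (hs₂ s (twist_ne_zero.1 hs)).1
      · rw [if_neg fun h => hg0 h.2, Nat.sub_zero]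
        -- Both values at `b` are positive, so the signs of the sequence do not change.
        refine h2.change_same_sign (t := b) hne ?_
        have h4 : 0 < g b := lt_of_le_of_ne hgb (Ne.symm hg0)
        have h5 : twist f₂ b * twist g b = ((-1) ^ b) ^ 2 * ((g b + v b) * g b) := by
          simp only [twist, hf₂, hf, if_true]; ring
        rw [h5, ← pow_mul, mul_comm b 2, pow_mul]
        simpa using mul_pos (add_pos_of_pos_of_nonneg h4 (hv b)) h4
    · rw [if_neg fun h => hbV h.1, Nat.sub_zero]
      refine (funext fun s => ?_ : twist g = twist f₂) ▸ h2
      by_cases hs : s = b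
      · have : v b = 0 := by
          by_contra h4
          exact hbV ((hV _).2 h4)
        simp [twist, hf₂, hf, hs, this]
      · exact hne s hs
  have h4 := AltChain.le_altLen hgV h3
  omega

end RowStep

end BallMaps

/-! ### Weights on exponents -/

set_option linter.unusedSectionVars false

namespace BallMaps

open MvPolynomial Finsupp

section Weights

variable {σ : Type*} [Fintype σ]

/-- The weight `∑ wᵢ αᵢ` of the exponent `α`. -/
def wt (w : σ → ℕ) (α : σ →₀ ℕ) : ℕ := ∑ i, w i * α i

theorem wt_add (w : σ → ℕ) (α β : σ →₀ ℕ) : wt w (α + β) = wt w α + wt w β := by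
  simp [wt, mul_add, Finset.sum_add_distrib]

@[simp] theorem wt_zero (α : σ →₀ ℕ) : wt 0 α = 0 := by simp [wt]

theorem apply_le_degree (α : σ →₀ ℕ) (i : σ) : α i ≤ α.degree := by
  rw [degree_eq_sum]
  exact Finset.single_le_sum (fun _ _ => Nat.zero_le _) (Finset.mem_univ i)

variable [DecidableEq σ]

@[simp] theorem wt_single (w : σ → ℕ) (i : σ) (m : ℕ) : wt w (single i m) = w i * m := by
  rw [wt, Finset.sum_eq_single i] <;> simp +contextual

/-- Exponents of degree at most `d` with the same weight agree in every coordinate of nonzero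
weight. -/
def Separates (d : ℕ) (w : σ → ℕ) : Prop :=
  ∀ α β : σ →₀ ℕ, α.degree ≤ d → β.degree ≤ d → wt w α = wt w β → ∀ r, w r ≠ 0 → α r = β r

/-- On exponents of degree at most `d`, comparing by `w'` refines comparing by `w`. -/
def Refines (d : ℕ) (w' w : σ → ℕ) : Prop :=
  ∀ α β : σ →₀ ℕ, α.degree ≤ d → β.degree ≤ d → wt w' α ≤ wt w' β → wt w α ≤ wt w β

theorem Refines.refl (d : ℕ) (w : σ → ℕ) : Refines d w w := fun _ _ _ _ h => h

theorem Refines.trans {d : ℕ} {w₁ w₂ w₃ : σ → ℕ} (h : Refines d w₁ w₂) (h' : Refines d w₂ w₃) :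
    Refines d w₁ w₃ := fun α β hα hβ hw => h' α β hα hβ (h α β hα hβ hw)

theorem Refines.eq {d : ℕ} {w' w : σ → ℕ} (h : Refines d w' w) {α β : σ →₀ ℕ} (hα : α.degree ≤ d)
    (hβ : β.degree ≤ d) (hw : wt w' α = wt w' β) : wt w α = wt w β :=
  le_antisymm (h α β hα hβ hw.le) (h β α hβ hα hw.ge)

/-- The weight comparing exponents of degree at most `d` lexicographically: by `w`, and then by
their `k`-th coordinate. -/
def refine (d : ℕ) (w : σ → ℕ) (k : σ) : σ → ℕ :=
  fun r => (d + 1) * w r + if r = k then 1 else 0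

theorem wt_refine (d : ℕ) (w : σ → ℕ) (k : σ) (α : σ →₀ ℕ) :
    wt (refine d w k) α = (d + 1) * wt w α + α k := by
  simp [wt, refine, add_mul, Finset.sum_add_distrib, Finset.mul_sum, mul_assoc]

theorem refine_eq_zero {d : ℕ} {w : σ → ℕ} {k r : σ} :
    refine d w k r = 0 ↔ w r = 0 ∧ r ≠ k := by
  simp [refine]

theorem wt_refine_lt {d : ℕ} {w : σ → ℕ} {k : σ} {α β : σ →₀ ℕ} (hα : α.degree ≤ d)
    (h : wt w α < wt w β) : wt (refine d w k) α < wt (refine d w k) β := by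
  rw [wt_refine, wt_refine]
  have := apply_le_degree α k
  nlinarith

theorem refines_refine (d : ℕ) (w : σ → ℕ) (k : σ) : Refines d (refine d w k) w := by
  intro α β _ hβ h
  by_contra! hlt
  exact absurd h (not_le.2 (wt_refine_lt hβ hlt))

theorem apply_le_of_wt_refine_le {d : ℕ} {w : σ → ℕ} {k : σ} {α β : σ →₀ ℕ}
    (hw : wt w α = wt w β) (h : wt (refine d w k) α ≤ wt (refine d w k) β) : α k ≤ β k := by
  rw [wt_refine, wt_refine, hw] at h
  omega

theorem apply_eq_of_wt_refine_eq {d : ℕ} {w : σ → ℕ} {k : σ} {α β : σ →₀ ℕ} (hα : α.degree ≤ d)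
    (hβ : β.degree ≤ d) (h : wt (refine d w k) α = wt (refine d w k) β) : α k = β k := by
  have hw := (refines_refine d w k).eq hα hβ h
  exact le_antisymm (apply_le_of_wt_refine_le hw h.le) (apply_le_of_wt_refine_le hw.symm h.ge)

theorem Separates.refine {d : ℕ} {w : σ → ℕ} (h : Separates d w) (k : σ) :
    Separates d (refine d w k) := by
  intro α β hα hβ hw r hr
  by_cases hk : r = k
  · exact hk ▸ apply_eq_of_wt_refine_eq hα hβ hw
  · refine h α β hα hβ ((refines_refine d w k).eq hα hβ hw) r fun h0 => hr ?_
    exact refine_eq_zero.2 ⟨h0, hk⟩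

theorem separates_zero (d : ℕ) : Separates d (0 : σ → ℕ) := fun _ _ _ _ _ _ h => absurd rfl h

theorem Separates.exists_refines {d : ℕ} {w : σ → ℕ} (h : Separates d w) (A : Finset σ) :
    ∃ w', Separates d w' ∧ Refines d w' w ∧ ∀ r, w' r = 0 ↔ w r = 0 ∧ r ∉ A := by
  induction A using Finset.induction_on with
  | empty => exact ⟨w, h, Refines.refl d w, by simp⟩
  | insert k A _ ih =>
    obtain ⟨w', h1, h2, h3⟩ := ih
    refine ⟨BallMaps.refine d w' k, h1.refine k, (refines_refine d w' k).trans h2, fun r => ?_⟩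
    rw [refine_eq_zero, h3]
    simp only [Finset.mem_insert, not_or]
    tauto

/-- Uniqueness of the exponent of given degree and weight when only one coordinate is weightless. -/
theorem Separates.eq_of_vertex {d : ℕ} {w : σ → ℕ} (h : Separates d w) {i : σ}
    (hi : ∀ r, w r = 0 → r = i) {α β : σ →₀ ℕ} (hα : α.degree ≤ d) (hd : α.degree = β.degree)
    (hw : wt w α = wt w β) : α = β := by
  have h1 : ∀ r, r ≠ i → α r = β r := fun r hr =>
    h α β hα (hd ▸ hα) hw r fun h0 => hr (hi r h0)
  ext r
  by_cases hr : r = i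
  · subst hr
    rw [degree_eq_sum, degree_eq_sum, ← Finset.add_sum_erase _ _ (Finset.mem_univ r),
      ← Finset.add_sum_erase _ _ (Finset.mem_univ r),
      Finset.sum_congr rfl fun s hs => h1 s (Finset.ne_of_mem_erase hs)] at hd
    exact Nat.add_right_cancel hd
  · exact h1 r hr

/-- Uniqueness of the exponent of given degree, weight and `k`-th coordinate when only `k` and one
other coordinate are weightless. -/
theorem Separates.eq_of_edge {d : ℕ} {w : σ → ℕ} (h : Separates d w) {i k : σ}
    (hi : ∀ r, w r = 0 → r = i ∨ r = k) {α β : σ →₀ ℕ} (hα : α.degree ≤ d)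
    (hd : α.degree = β.degree) (hw : wt w α = wt w β) (hk : α k = β k) : α = β := by
  have h1 : ∀ r, r ≠ i → α r = β r := fun r hr => by
    by_cases hrk : r = k
    · rw [hrk, hk]
    · exact h α β hα (hd ▸ hα) hw r fun h0 => (hi r h0).elim hr hrk
  ext r
  by_cases hr : r = i
  · subst hr
    rw [degree_eq_sum, degree_eq_sum, ← Finset.add_sum_erase _ _ (Finset.mem_univ r),
      ← Finset.add_sum_erase _ _ (Finset.mem_univ r),
      Finset.sum_congr rfl fun s hs => h1 s (Finset.ne_of_mem_erase hs)] at hd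
    exact Nat.add_right_cancel hd
  · exact h1 r hr

end Weights

/-! ### The quotient of `1 - p` by `1 - ∑ xᵢ` -/

section Quotient

variable {σ : Type*} [Fintype σ] [DecidableEq σ]

/-- `p` is a polynomial of degree `d ≥ 1` with nonnegative coefficients, equal to `1` on the
hyperplane `∑ xᵢ = 1`; the latter is witnessed by the quotient `q`. -/
structure IsHyperplanePair (p q : MvPolynomial σ ℝ) (d : ℕ) : Prop where
  coeff_nonneg : ∀ α, 0 ≤ p.coeff α
  mul_eq : 1 - p = (1 - ∑ i, X i) * q
  totalDegree_eq : p.totalDegree = d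
  one_le : 1 ≤ d

namespace IsHyperplanePair

variable {p q : MvPolynomial σ ℝ} {d : ℕ} (h : IsHyperplanePair p q d)
include h

theorem coeff_add_coeff {α : σ →₀ ℕ} (hα : α ≠ 0) :
    q.coeff α + p.coeff α = ∑ i, if α i = 0 then 0 else q.coeff (α - single i 1) := by
  have h1 := congrArg (coeff α) h.mul_eq
  rw [sub_mul, Finset.sum_mul, one_mul, coeff_sub, coeff_sub, coeff_one, if_neg hα.symm,
    coeff_sum] at h1
  have h2 : ∑ i, coeff α (X i * q) = ∑ i, if α i = 0 then 0 else q.coeff (α - single i 1) :=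
    Finset.sum_congr rfl fun i _ => by rw [coeff_X_mul']; simp
  rw [h2] at h1
  linarith

theorem degree_le {α : σ →₀ ℕ} (hα : p.coeff α ≠ 0) : α.degree ≤ d := by
  rw [← h.totalDegree_eq]
  exact le_totalDegree (MvPolynomial.mem_support_iff.2 hα)

theorem exists_degree_eq : ∃ α, p.coeff α ≠ 0 ∧ α.degree = d := by
  have h0 : p.support.Nonempty := by
    rw [Finset.nonempty_iff_ne_empty]
    intro h0
    have := h.one_le
    rw [← h.totalDegree_eq, MvPolynomial.support_eq_empty.1 h0, totalDegree_zero] at this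
    omega
  obtain ⟨α, hα, hd⟩ := Finset.exists_mem_eq_sup p.support h0 fun s => s.sum fun _ e => e
  exact ⟨α, MvPolynomial.mem_support_iff.1 hα, hd.symm.trans h.totalDegree_eq⟩

theorem degree_lt {α : σ →₀ ℕ} (hα : q.coeff α ≠ 0) : α.degree < d := by
  have h0 : (1 - p).totalDegree = d := by
    have := totalDegree_add_eq_right_of_totalDegree_lt (p := -p) (q := 1)
    rw [totalDegree_neg, totalDegree_one, h.totalDegree_eq] at this
    rw [sub_eq_add_neg, this h.one_le]
  have hne : (1 - p) ≠ 0 := fun h1 => by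
    have := h.one_le
    rw [h1, totalDegree_zero] at h0
    omega
  have hs : 1 ≤ (1 - ∑ i, X i : MvPolynomial σ ℝ).totalDegree := by
    obtain ⟨β, _, hβ⟩ := h.exists_degree_eq
    have hβ0 : β ≠ 0 := by
      rintro rfl
      have := h.one_le
      simp at hβ
      omega
    obtain ⟨i, hi⟩ := Finsupp.ne_iff.1 hβ0
    have h1 : single i 1 ∈ (1 - ∑ i, X i : MvPolynomial σ ℝ).support := by
      have h2 : (0 : σ →₀ ℕ) ≠ single i 1 := fun h3 => by
        simpa using DFunLike.congr_fun h3 i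
      simp [coeff_sub, coeff_one, coeff_sum, coeff_X, h2, Finsupp.single_left_inj]
    simpa using le_totalDegree h1
  rw [h.mul_eq] at hne h0
  rw [totalDegree_mul_of_isDomain (left_ne_zero_of_mul hne) (right_ne_zero_of_mul hne)] at h0
  have h2 : α.degree ≤ q.totalDegree := le_totalDegree (MvPolynomial.mem_support_iff.2 hα)
  omega

theorem coeff_add_single {i : σ} {α : σ →₀ ℕ}
    (hw : ∀ r ≠ i, ∀ β : σ →₀ ℕ, β + single r 1 = α + single i 1 → q.coeff β = 0) :
    q.coeff (α + single i 1) + p.coeff (α + single i 1) = q.coeff α := by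
  rw [h.coeff_add_coeff, Finset.sum_eq_single i]
  · simp
  · intro r _ hr
    split_ifs with h0
    · rfl
    · refine hw r hr _ (tsub_add_cancel_of_le ?_)
      rw [single_le_iff]
      omega
  · simp
  · intro h0
    simpa using DFunLike.congr_fun h0 i

theorem coeff_eq_neg_of_forall {α : σ →₀ ℕ} (hα : α ≠ 0)
    (hw : ∀ r, ∀ β : σ →₀ ℕ, β + single r 1 = α → q.coeff β = 0) :
    q.coeff α = - p.coeff α := by
  have h1 := h.coeff_add_coeff hα
  rw [Finset.sum_eq_zero] at h1
  · linarith
  · intro r _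
    split_ifs with h0
    · rfl
    · refine hw r _ (tsub_add_cancel_of_le ?_)
      rw [single_le_iff]
      omega

/-- The vertices of the homogeneous parts of `q` carry nonnegative coefficients: a negative
coefficient at a vertex would produce another one in the next degree, and so on for ever. -/
theorem coeff_nonneg_of_vertex {w : σ → ℕ} (hsep : Separates d w) {i : σ} (hi : ∀ r, w r = 0 ↔ r = i)
    (α : σ →₀ ℕ) (hmin : ∀ β, q.coeff β ≠ 0 → β.degree = α.degree → wt w α ≤ wt w β) :
    0 ≤ q.coeff α := by
  by_contra! hneg
  obtain ⟨m, hm⟩ : ∃ m, α.degree + m = d :=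
    ⟨d - α.degree, by have := h.degree_lt hneg.ne; omega⟩
  induction m generalizing α with
  | zero => have := h.degree_lt hneg.ne; omega
  | succ m ih =>
    have h1 : q.coeff (α + single i 1) < 0 := by
      have h2 := h.coeff_add_single (i := i) (α := α) fun r hr β hβ => by
        by_contra hβ0
        have hd := congrArg Finsupp.degree hβ
        rw [map_add, map_add, degree_single, degree_single] at hd
        have h3 := hmin β hβ0 (by omega)
        have h4 := congrArg (wt w) hβ
        rw [wt_add, wt_add, wt_single, wt_single, (hi i).2 rfl] at h4
        have h5 : w r ≠ 0 := fun h0 => hr ((hi r).1 h0)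
        omega
      have := h.coeff_nonneg (α + single i 1)
      linarith
    have hdeg : (α + single i 1).degree = α.degree + 1 := by rw [map_add, degree_single]
    -- the exponent of least weight in the next degree
    obtain ⟨β, hβ, hβmin⟩ := Finset.exists_min_image
      (q.support.filter fun β => β.degree = α.degree + 1) (wt w)
      ⟨α + single i 1, by simp [h1.ne, hdeg]⟩
    simp only [Finset.mem_filter, MvPolynomial.mem_support_iff] at hβ hβmin
    have hle := hβmin _ ⟨h1.ne, hdeg⟩
    rw [wt_add, wt_single, (hi i).2 rfl, zero_mul, add_zero] at hle
    refine ih β (fun γ h2 h3 => hβmin γ ⟨h2, h3.trans hβ.2⟩) ?_ (by omega)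
    rcases hle.lt_or_eq with hlt | heq
    · have h2 := h.coeff_eq_neg_of_forall (α := β) (fun h0 => by simp [h0] at hβ) fun r γ hγ => by
        by_contra h0
        have hd := congrArg Finsupp.degree hγ
        rw [map_add, degree_single, hβ.2] at hd
        have h3 := hmin γ h0 (by omega)
        have h4 := congrArg (wt w) hγ
        rw [wt_add] at h4
        omega
      rw [h2]
      have := h.coeff_nonneg β
      refine neg_lt_zero.2 (lt_of_le_of_ne this fun h0 => hβ.1 ?_)
      rw [h2, ← h0, neg_zero]
    · rw [hsep.eq_of_vertex (fun r hr => (hi r).1 hr) (h.degree_lt hβ.1).le (hβ.2.trans hdeg.symm)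
        (heq.trans (by simp [wt_add, (hi i).2 rfl]))]
      exact h1

/-- Both `p` and `q` are supported, in degree `j + 1`, where the weight is at least its minimum over
the support of `q` in degree `j`. -/
theorem exists_wt_le {w : σ → ℕ} (hsep : Separates d w) {i : σ} (hi : w i = 0)
    {j : ℕ} {α : σ →₀ ℕ} (hα : α.degree = j + 1) (hne : q.coeff α ≠ 0 ∨ p.coeff α ≠ 0) :
    ∃ β, q.coeff β ≠ 0 ∧ β.degree = j ∧ wt w β ≤ wt w α := by
  by_contra! hlt
  obtain ⟨w', hsep', hw', hz⟩ := hsep.exists_refines (Finset.univ.erase i)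
  have hi' : ∀ r, w' r = 0 ↔ r = i := fun r => by
    rw [hz]
    simp only [Finset.mem_erase, Finset.mem_univ, and_true, not_not]
    exact ⟨fun h => h.2, fun h => ⟨h ▸ hi, h⟩⟩
  have hαd : α.degree ≤ d := hne.elim (fun h0 => (h.degree_lt h0).le) h.degree_le
  have key : ∀ γ : σ →₀ ℕ, γ.degree = j + 1 → wt w γ ≤ wt w α → q.coeff γ = - p.coeff γ := by
    intro γ hγ hγw
    refine h.coeff_eq_neg_of_forall (fun h0 => by simp [h0] at hγ) fun r β hβ => ?_
    by_contra h0
    have hd := congrArg Finsupp.degree hβ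
    rw [map_add, degree_single, hγ] at hd
    have h3 := hlt β h0 (by omega)
    have h4 := congrArg (wt w) hβ
    rw [wt_add] at h4
    omega
  have hqα : q.coeff α ≠ 0 := by
    rcases hne with h0 | h0
    · exact h0
    · rw [key α hα le_rfl]
      simpa using h0
  obtain ⟨γ, hγ, hγmin⟩ := Finset.exists_min_image
    (q.support.filter fun β => β.degree = j + 1) (wt w') ⟨α, by simp [hqα, hα]⟩
  simp only [Finset.mem_filter, MvPolynomial.mem_support_iff] at hγ hγmin
  have h1 := h.coeff_nonneg_of_vertex hsep' hi' γ fun β h2 h3 => hγmin β ⟨h2, h3.trans hγ.2⟩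
  have h2 := key γ hγ.2 (hw' γ α (h.degree_lt hγ.1).le hαd (hγmin α ⟨hqα, hα⟩))
  have h3 := h.coeff_nonneg γ
  exact hγ.1 (by linarith)

theorem exists_coeff_ne_zero {j : ℕ} (hj : j < d) : ∃ α, q.coeff α ≠ 0 ∧ α.degree = j := by
  by_contra! hc
  obtain ⟨β, hβ, hβd⟩ := h.exists_degree_eq
  have hne : Nonempty σ := by
    by_contra h0
    rw [not_nonempty_iff] at h0
    have : β = 0 := Subsingleton.elim _ _
    simp [this] at hβd
    omega
  obtain ⟨i⟩ := hne
  -- an empty degree forces all higher degrees of `p` and `q` to be empty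
  have key : ∀ m, j ≤ m → ∀ α, q.coeff α ≠ 0 → α.degree ≠ m := by
    intro m hm
    induction m, hm using Nat.le_induction with
    | base => exact hc
    | succ m _ ih =>
      intro α hα hd
      obtain ⟨γ, h1, h2, _⟩ :=
        h.exists_wt_le (separates_zero d) (i := i) rfl hd (Or.inl hα)
      exact ih γ h1 h2
  obtain ⟨γ, h1, h2, _⟩ := h.exists_wt_le (separates_zero d) (i := i) rfl
    (show β.degree = (d - 1) + 1 by omega) (Or.inr hβ)
  exact key (d - 1) (by omega) γ h1 h2

end IsHyperplanePair

end Quotient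

end BallMaps

namespace BallMaps

open MvPolynomial Finsupp

section Faces

variable {σ : Type*} [Fintype σ] [DecidableEq σ]

/-- The least weight of an exponent of degree `j` in the support of `q` (and `0` if there is no such
exponent). The exponents attaining it form the `w`-face of `q` in degree `j`. -/
noncomputable def minWt (q : MvPolynomial σ ℝ) (w : σ → ℕ) (j : ℕ) : ℕ :=
  sInf {m | ∃ α, q.coeff α ≠ 0 ∧ α.degree = j ∧ wt w α = m}

/-- The terms of `p` of degree `j + 1` whose weight is the one of the `w`-face of `q` in degree
`j`. -/
noncomputable def faceTerms (p q : MvPolynomial σ ℝ) (w : σ → ℕ) (j : ℕ) : Finset (σ →₀ ℕ) :=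
  p.support.filter fun α => α.degree = j + 1 ∧ wt w α = minWt q w j

/-- The `w`-face of `q` in degree `j` survives to degree `j + 1` if its weight still occurs in the
support of `q` there. -/
def Survives (q : MvPolynomial σ ℝ) (w : σ → ℕ) (j : ℕ) : Prop :=
  ∃ α, q.coeff α ≠ 0 ∧ α.degree = j + 1 ∧ wt w α = minWt q w j

/-- The least `k`-th coordinate on the `w`-face of `q` in degree `j`. -/
noncomputable def minCoord (q : MvPolynomial σ ℝ) (d : ℕ) (w : σ → ℕ) (k : σ) (j : ℕ) : ℕ :=
  minWt q (refine d w k) j - (d + 1) * minWt q w j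

theorem mem_faceTerms {p q : MvPolynomial σ ℝ} {w : σ → ℕ} {j : ℕ} {α : σ →₀ ℕ} :
    α ∈ faceTerms p q w j ↔ p.coeff α ≠ 0 ∧ α.degree = j + 1 ∧ wt w α = minWt q w j := by
  simp [faceTerms]

theorem minWt_le {q : MvPolynomial σ ℝ} (w : σ → ℕ) {j : ℕ} {α : σ →₀ ℕ} (hα : q.coeff α ≠ 0)
    (hd : α.degree = j) : minWt q w j ≤ wt w α :=
  Nat.sInf_le ⟨α, hα, hd, rfl⟩

namespace IsHyperplanePair

variable {p q : MvPolynomial σ ℝ} {d : ℕ} (h : IsHyperplanePair p q d)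
include h

theorem exists_wt_eq_minWt (w : σ → ℕ) {j : ℕ} (hj : j < d) :
    ∃ α, q.coeff α ≠ 0 ∧ α.degree = j ∧ wt w α = minWt q w j := by
  obtain ⟨α, h1, h2⟩ := h.exists_coeff_ne_zero hj
  exact Nat.sInf_mem (s := {m | ∃ α, q.coeff α ≠ 0 ∧ α.degree = j ∧ wt w α = m})
    ⟨_, α, h1, h2, rfl⟩

theorem minWt_le_wt {w : σ → ℕ} (hsep : Separates d w) {i : σ} (hi : w i = 0)
    {j : ℕ} {α : σ →₀ ℕ} (hα : α.degree = j + 1) (hne : q.coeff α ≠ 0 ∨ p.coeff α ≠ 0) :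
    minWt q w j ≤ wt w α := by
  obtain ⟨β, h1, h2, h3⟩ := h.exists_wt_le hsep hi hα hne
  exact (minWt_le w h1 h2).trans h3

theorem wt_eq_minWt_of_refines {w w' : σ → ℕ} (hw : Refines d w' w) {j : ℕ} (hj : j < d)
    {α : σ →₀ ℕ} (hα : α.degree ≤ d) (hw' : wt w' α = minWt q w' j) : wt w α = minWt q w j := by
  obtain ⟨β, h1, h2, h3⟩ := h.exists_wt_eq_minWt w' hj
  obtain ⟨γ, h4, h5, h6⟩ := h.exists_wt_eq_minWt w hj
  rw [hw.eq hα (by omega) (hw'.trans h3.symm)]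
  refine le_antisymm ?_ (minWt_le w h1 h2)
  rw [← h6]
  refine hw β γ (by omega) (by omega) ?_
  rw [h3]
  exact minWt_le w' h4 h5

theorem survives_of_refines {w w' : σ → ℕ} (hw : Refines d w' w) {j : ℕ} (hj : j < d)
    (hs : Survives q w' j) : Survives q w j := by
  obtain ⟨α, h1, h2, h3⟩ := hs
  exact ⟨α, h1, h2, h.wt_eq_minWt_of_refines hw hj (by omega) h3⟩

theorem lt_of_survives {w : σ → ℕ} {j : ℕ} (hs : Survives q w j) : j + 1 < d := by
  obtain ⟨α, h1, h2, _⟩ := hs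
  exact h2 ▸ h.degree_lt h1

theorem minWt_succ_of_survives {w : σ → ℕ} (hsep : Separates d w) {i : σ} (hi : w i = 0) {j : ℕ}
    (hs : Survives q w j) : minWt q w (j + 1) = minWt q w j := by
  obtain ⟨β, h4, h5, h6⟩ := h.exists_wt_eq_minWt w (h.lt_of_survives hs)
  obtain ⟨α, h1, h2, h3⟩ := hs
  refine le_antisymm (h3 ▸ minWt_le w h1 h2) ?_
  rw [← h6]
  exact h.minWt_le_wt hsep hi h5 (Or.inl h4)

theorem minWt_refine {w : σ → ℕ} (k : σ) {j : ℕ} (hj : j < d) :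
    minWt q (refine d w k) j = (d + 1) * minWt q w j + minCoord q d w k j := by
  obtain ⟨β, h1, h2, h3⟩ := h.exists_wt_eq_minWt (refine d w k) hj
  have h4 := h.wt_eq_minWt_of_refines (refines_refine d w k) hj (by omega) h3
  rw [minCoord, ← h3, wt_refine, h4]
  omega

theorem wt_refine_eq_minWt_iff {w : σ → ℕ} (k : σ) {j : ℕ} (hj : j < d) {α : σ →₀ ℕ}
    (hα : α.degree ≤ d) : wt (refine d w k) α = minWt q (refine d w k) j ↔
      wt w α = minWt q w j ∧ α k = minCoord q d w k j := by
  constructor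
  · intro h3
    have h4 := h.wt_eq_minWt_of_refines (refines_refine d w k) hj hα h3
    refine ⟨h4, ?_⟩
    rw [h.minWt_refine k hj, wt_refine, h4] at h3
    omega
  · rintro ⟨h1, h2⟩
    rw [h.minWt_refine k hj, wt_refine, h1, h2]

theorem minCoord_le {w : σ → ℕ} (k : σ) {j : ℕ} {α : σ →₀ ℕ}
    (hα : q.coeff α ≠ 0) (hd : α.degree = j) (hw : wt w α = minWt q w j) :
    minCoord q d w k j ≤ α k := by
  have h1 := minWt_le (refine d w k) hα hd
  rw [h.minWt_refine k (hd ▸ h.degree_lt hα), wt_refine, hw] at h1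
  omega

theorem minCoord_le_succ {w : σ → ℕ} (hsep : Separates d w) {i k : σ} (hi : w i = 0) (hik : i ≠ k)
    {j : ℕ} (hj : j < d) {α : σ →₀ ℕ} (hd : α.degree = j + 1)
    (hα : q.coeff α ≠ 0 ∨ p.coeff α ≠ 0) (hw : wt w α = minWt q w j) :
    minCoord q d w k j ≤ α k := by
  have h1 := h.minWt_le_wt (hsep.refine k) (refine_eq_zero.2 ⟨hi, hik⟩) hd hα
  rw [h.minWt_refine k hj, wt_refine, hw] at h1
  omega

theorem minCoord_succ_of_survives {w : σ → ℕ} (hsep : Separates d w) {i k : σ} (hi : w i = 0)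
    (hik : i ≠ k) {j : ℕ} (hj : j < d) (hs : Survives q (BallMaps.refine d w k) j) :
    minCoord q d w k (j + 1) = minCoord q d w k j := by
  rw [minCoord, minCoord, h.minWt_succ_of_survives (hsep.refine k) (refine_eq_zero.2 ⟨hi, hik⟩) hs,
    h.minWt_succ_of_survives hsep hi (h.survives_of_refines (refines_refine d w k) hj hs)]

end IsHyperplanePair

end Faces

/-! ### The dynamics of a row -/

section Rows

variable {σ : Type*} [Fintype σ] [DecidableEq σ]

/-- The coefficients of `f` along the exponents of degree `l` and weight `m`, listed by their `k`-th
coordinate. When `w` separates and vanishes only at `k` and one other index, every sum has at most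
one summand. -/
noncomputable def rowSeq (f : MvPolynomial σ ℝ) (w : σ → ℕ) (k : σ) (l m t : ℕ) : ℝ :=
  ∑ α ∈ f.support.filter fun α => α.degree = l ∧ wt w α = m ∧ α k = t, f.coeff α

/-- The weight `w` separates exponents of degree at most `d`, and vanishes exactly at the two
distinct indices `i` and `k`. -/
structure IsEdgeWeight (d : ℕ) (w : σ → ℕ) (i k : σ) : Prop where
  separates : Separates d w
  eq_zero_iff : ∀ r, w r = 0 ↔ r = i ∨ r = k
  ne : i ≠ k

theorem exists_of_rowSeq_ne_zero {f : MvPolynomial σ ℝ} {w : σ → ℕ} {k : σ} {l m t : ℕ}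
    (ht : rowSeq f w k l m t ≠ 0) :
    ∃ α, f.coeff α ≠ 0 ∧ α.degree = l ∧ wt w α = m ∧ α k = t := by
  obtain ⟨α, hα, _⟩ := Finset.exists_ne_zero_of_sum_ne_zero ht
  simp only [Finset.mem_filter, MvPolynomial.mem_support_iff] at hα
  exact ⟨α, hα⟩

theorem IsEdgeWeight.rowSeq_apply {d : ℕ} {w : σ → ℕ} {i k : σ} (hw : IsEdgeWeight d w i k)
    (f : MvPolynomial σ ℝ) {α : σ →₀ ℕ} (hα : α.degree ≤ d) :
    rowSeq f w k α.degree (wt w α) (α k) = f.coeff α := by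
  rw [rowSeq]
  have huniq : ∀ β : σ →₀ ℕ, β.degree = α.degree → wt w β = wt w α → β k = α k → β = α :=
    fun β h1 h2 h3 => hw.separates.eq_of_edge (fun r hr => (hw.eq_zero_iff r).1 hr)
      (h1 ▸ hα) h1 h2 h3
  by_cases h0 : f.coeff α = 0
  · rw [h0]
    refine Finset.sum_eq_zero fun β hβ => ?_
    simp only [Finset.mem_filter] at hβ
    rw [huniq β hβ.2.1 hβ.2.2.1 hβ.2.2.2, h0]
  · refine Finset.sum_eq_single_of_mem α (by simp [h0]) fun β hβ hne => ?_
    simp only [Finset.mem_filter] at hβ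
    exact absurd (huniq β hβ.2.1 hβ.2.2.1 hβ.2.2.2) hne

namespace IsHyperplanePair

variable {p q : MvPolynomial σ ℝ} {d : ℕ} (h : IsHyperplanePair p q d)
include h

/-- Along the `w`-face, multiplication by `1 - ∑ xᵣ` only sees the two weightless variables. -/
theorem rowSeq_rec {w : σ → ℕ} {i k : σ} (hw : IsEdgeWeight d w i k) {j : ℕ} (hj : j < d) (t : ℕ) :
    rowSeq q w k (j + 1) (minWt q w j) t + rowSeq p w k (j + 1) (minWt q w j) t =
      rowSeq q w k j (minWt q w j) t +
        if t = 0 then 0 else rowSeq q w k j (minWt q w j) (t - 1) := by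
  have hwi : w i = 0 := (hw.eq_zero_iff i).2 (Or.inl rfl)
  have hwk : w k = 0 := (hw.eq_zero_iff k).2 (Or.inr rfl)
  by_cases hex : ∃ α : σ →₀ ℕ, α.degree = j + 1 ∧ wt w α = minWt q w j ∧ α k = t
  · obtain ⟨α, hd, hα, rfl⟩ := hex
    have hαd : α.degree ≤ d := by omega
    have e1 := hw.rowSeq_apply q hαd
    have e2 := hw.rowSeq_apply p hαd
    rw [hd, hα] at e1 e2
    rw [e1, e2, h.coeff_add_coeff (fun h0 => by simp [h0] at hd),
      Finset.sum_eq_add i k hw.ne]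
    · congr 1
      · split_ifs with h0
        · by_contra hne
          obtain ⟨β, _, h2, h3, h4⟩ := exists_of_rowSeq_ne_zero (Ne.symm hne)
          have h5 : β + single i 1 = α :=
            hw.separates.eq_of_edge (fun r hr => (hw.eq_zero_iff r).1 hr)
              (by rw [map_add, degree_single]; omega) (by rw [map_add, degree_single]; omega)
              (by rw [wt_add, wt_single, hwi]; omega) (by simp [hw.ne, h4])
          have := DFunLike.congr_fun h5 i
          simp at this
          omega
        · have hle : single i 1 ≤ α := by rw [single_le_iff]; omega
          have h5 := congrArg (wt w) (tsub_add_cancel_of_le hle)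
          have h6 := congrArg Finsupp.degree (tsub_add_cancel_of_le hle)
          rw [wt_add, wt_single, hwi] at h5
          rw [map_add, degree_single] at h6
          have h7 := hw.rowSeq_apply q (α := α - single i 1) (by omega)
          rw [show Finsupp.degree (α - single i 1) = j by omega,
            show wt w (α - single i 1) = minWt q w j by omega] at h7
          simpa [hw.ne.symm, Finsupp.single_apply, hw.ne] using h7.symm
      · split_ifs with h0
        · rfl
        · have hle : single k 1 ≤ α := by rw [single_le_iff]; omega
          have h5 := congrArg (wt w) (tsub_add_cancel_of_le hle)
          have h6 := congrArg Finsupp.degree (tsub_add_cancel_of_le hle)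
          rw [wt_add, wt_single, hwk] at h5
          rw [map_add, degree_single] at h6
          have h7 := hw.rowSeq_apply q (α := α - single k 1) (by omega)
          rw [show Finsupp.degree (α - single k 1) = j by omega,
            show wt w (α - single k 1) = minWt q w j by omega] at h7
          simpa using h7.symm
    · intro r _ hr
      split_ifs with h0
      · rfl
      · by_contra hne
        have hle : single r 1 ≤ α := by rw [single_le_iff]; omega
        have h5 := congrArg (wt w) (tsub_add_cancel_of_le hle)
        have h6 := congrArg Finsupp.degree (tsub_add_cancel_of_le hle)
        rw [wt_add, wt_single] at h5
        rw [map_add, degree_single] at h6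
        have h7 := minWt_le w hne (j := j) (by omega)
        have h8 : w r ≠ 0 := fun h9 => by
          have := (hw.eq_zero_iff r).1 h9
          tauto
        omega
    · simp
    · simp
  · have hz : ∀ f : MvPolynomial σ ℝ, rowSeq f w k (j + 1) (minWt q w j) t = 0 := fun f => by
      by_contra hne
      obtain ⟨β, _, h2, h3, h4⟩ := exists_of_rowSeq_ne_zero hne
      exact hex ⟨β, h2, h3, h4⟩
    rw [hz, hz]
    have h1 : rowSeq q w k j (minWt q w j) t = 0 := by
      by_contra hne
      obtain ⟨β, _, h2, h3, h4⟩ := exists_of_rowSeq_ne_zero hne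
      refine hex ⟨β + single i 1, by rw [map_add, degree_single]; omega,
        by rw [wt_add, wt_single, hwi]; omega, by simp [hw.ne, h4]⟩
    rw [h1]
    split_ifs with h0
    · rfl
    · by_contra hne
      rw [zero_add, zero_add] at hne
      obtain ⟨β, _, h2, h3, h4⟩ := exists_of_rowSeq_ne_zero (Ne.symm hne)
      refine hex ⟨β + single k 1, by rw [map_add, degree_single]; omega,
        by rw [wt_add, wt_single, hwk]; omega, by simp [h4]; omega⟩

end IsHyperplanePair

/-- The length of the longest alternating chain of the row of the `w`-face in degree `j`. A nonzero
row has length at least `1`; the maximum makes this hold after the last degree too. -/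
noncomputable def rowLen (q : MvPolynomial σ ℝ) (w : σ → ℕ) (k : σ) (j : ℕ) : ℕ :=
  max 1 (altLen (rowSeq q w k j (minWt q w j)))

/-- The positions, along the row, of the terms of `p` that are subtracted in the `j`-th step. -/
noncomputable def rowTerms (p q : MvPolynomial σ ℝ) (w : σ → ℕ) (k : σ) (j : ℕ) : Finset ℕ :=
  (faceTerms p q w j).image fun α => α k

namespace IsHyperplanePair

variable {p q : MvPolynomial σ ℝ} {d : ℕ} (h : IsHyperplanePair p q d)
include h

theorem mem_rowTerms {w : σ → ℕ} {i k : σ} (hw : IsEdgeWeight d w i k) {j : ℕ} (hj : j < d)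
    (t : ℕ) : t ∈ rowTerms p q w k j ↔ rowSeq p w k (j + 1) (minWt q w j) t ≠ 0 := by
  simp only [rowTerms, Finset.mem_image, mem_faceTerms]
  constructor
  · rintro ⟨α, ⟨h1, h2, h3⟩, rfl⟩
    rw [← h2, ← h3, hw.rowSeq_apply p (by omega)]
    exact h1
  · intro hne
    obtain ⟨β, h1, h2, h3, h4⟩ := exists_of_rowSeq_ne_zero hne
    exact ⟨β, ⟨h1, h2, h3⟩, h4⟩

theorem card_rowTerms {w : σ → ℕ} {i k : σ} (hw : IsEdgeWeight d w i k) {j : ℕ} (hj : j < d) :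
    (rowTerms p q w k j).card = (faceTerms p q w j).card := by
  refine Finset.card_image_of_injOn fun α hα β hβ hab => ?_
  rw [Finset.mem_coe, mem_faceTerms] at hα hβ
  exact hw.separates.eq_of_edge (fun r hr => (hw.eq_zero_iff r).1 hr) (by omega)
    (hα.2.1.trans hβ.2.1.symm) (hα.2.2.trans hβ.2.2.symm) hab

theorem rowSeq_nonneg (w : σ → ℕ) (k : σ) (l m t : ℕ) : 0 ≤ rowSeq p w k l m t :=
  Finset.sum_nonneg fun α _ => h.coeff_nonneg α

theorem exists_rowSeq_ne_zero {w : σ → ℕ} {i k : σ} (hw : IsEdgeWeight d w i k) {j : ℕ}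
    (hj : j < d) : ∃ t, rowSeq q w k j (minWt q w j) t ≠ 0 := by
  obtain ⟨α, h1, h2, h3⟩ := h.exists_wt_eq_minWt w hj
  refine ⟨α k, ?_⟩
  have h4 := hw.rowSeq_apply q (α := α) (by omega)
  rw [h2, h3] at h4
  rwa [h4]

/-- The bottom entry of a row is a vertex of the homogeneous part of `q`. -/
theorem rowSeq_bot_nonneg {w : σ → ℕ} {i k : σ} (hw : IsEdgeWeight d w i k) {j : ℕ} {b : ℕ}
    (hb : ∀ α, q.coeff α ≠ 0 → α.degree = j + 1 → wt w α = minWt q w j → b ≤ α k) :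
    0 ≤ rowSeq q w k (j + 1) (minWt q w j) b := by
  by_cases h0 : rowSeq q w k (j + 1) (minWt q w j) b = 0
  · exact h0.ge
  obtain ⟨α, h1, h2, h3, h4⟩ := exists_of_rowSeq_ne_zero h0
  have hαd := h.degree_lt h1
  rw [← h4, ← h3, ← h2, hw.rowSeq_apply q hαd.le]
  have hwi : w i = 0 := (hw.eq_zero_iff i).2 (Or.inl rfl)
  refine h.coeff_nonneg_of_vertex (hw.separates.refine k) (i := i) (fun r => ?_) α
    fun β h5 h6 => ?_
  · rw [refine_eq_zero, hw.eq_zero_iff]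
    have := hw.ne
    constructor
    · tauto
    · rintro rfl
      exact ⟨Or.inl rfl, this⟩
  · have h7 := h.minWt_le_wt hw.separates hwi (h6.trans h2) (Or.inl h5)
    rcases h7.lt_or_eq with h8 | h8
    · exact (wt_refine_lt hαd.le (h3.trans_lt h8)).le
    · rw [wt_refine, wt_refine, h3, ← h8, h4]
      have := hb β h5 (h6.trans h2) h8.symm
      omega

theorem rowLen_dead {w : σ → ℕ} {i k : σ} (hw : IsEdgeWeight d w i k) {j : ℕ} (hj : j < d)
    (hs : ¬ Survives q w j) : rowLen q w k j + 1 ≤ (rowTerms p q w k j).card := by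
  have hV : ∀ t, rowSeq q w k j (minWt q w j) t ≠ 0 → 0 ≤ t ∧ t < d := fun t ht => by
    obtain ⟨α, h1, h2, h3, rfl⟩ := exists_of_rowSeq_ne_zero ht
    have := apply_le_degree α k
    omega
  have h1 := altLen_add_one_le_card (V := rowTerms p q w k j) hV
    (h.exists_rowSeq_ne_zero hw hj) (h.rowSeq_rec hw hj)
    (fun t => by
      by_contra h0
      obtain ⟨α, h1, h2, h3, rfl⟩ := exists_of_rowSeq_ne_zero h0
      exact hs ⟨α, h1, h2, h3⟩) (h.mem_rowTerms hw hj)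
  obtain ⟨t, ht⟩ := h.exists_rowSeq_ne_zero hw hj
  have h2 := one_le_altLen (V := Finset.range d) (fun t ht => by simpa using (hV t ht).2) ht
  rw [rowLen]
  omega

theorem rowLen_alive {w : σ → ℕ} {i k : σ} (hw : IsEdgeWeight d w i k) {j : ℕ} (hj : j < d)
    (hs : Survives q w j) {b τ : ℕ}
    (hb : ∀ α, q.coeff α ≠ 0 → α.degree = j → wt w α = minWt q w j → b ≤ α k ∧ α k < τ)
    (hb' : ∀ α, q.coeff α ≠ 0 → α.degree = j + 1 → wt w α = minWt q w j → b ≤ α k ∧ α k ≤ τ) :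
    rowLen q w k j + 1 ≤ rowLen q w k (j + 1) + 2 * (rowTerms p q w k j \ {b, τ}).card +
      (if τ ∈ rowTerms p q w k j then 1 else 0) +
      (if b ∈ rowTerms p q w k j ∧ rowSeq q w k (j + 1) (minWt q w j) b = 0 then 1 else 0) := by
  have hV : ∀ t, rowSeq q w k j (minWt q w j) t ≠ 0 → b ≤ t ∧ t < τ := fun t ht => by
    obtain ⟨α, h1, h2, h3, rfl⟩ := exists_of_rowSeq_ne_zero ht
    exact hb α h1 h2 h3
  have h1 := altLen_step (V := rowTerms p q w k j) hV
    (h.exists_rowSeq_ne_zero hw hj) (h.rowSeq_rec hw hj) (h.rowSeq_nonneg w k _ _)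
    (fun t ht => by
      obtain ⟨α, h1, h2, h3, rfl⟩ := exists_of_rowSeq_ne_zero ht
      exact hb' α h1 h2 h3)
    (h.rowSeq_bot_nonneg hw fun α h1 h2 h3 => (hb' α h1 h2 h3).1) (h.mem_rowTerms hw hj)
  obtain ⟨t, ht⟩ := h.exists_rowSeq_ne_zero hw hj
  have h2 := one_le_altLen (V := Finset.range τ) (fun t ht => by simpa using (hV t ht).2) ht
  rw [rowLen, rowLen,
    h.minWt_succ_of_survives hw.separates ((hw.eq_zero_iff i).2 (Or.inl rfl)) hs]
  omega

end IsHyperplanePair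

end Rows

end BallMaps

/-! ### Counting terms -/

namespace BallMaps

open MvPolynomial Finsupp

theorem card_sdiff_pair (V : Finset ℕ) {b τ : ℕ} (hbτ : b ≠ τ) :
    (V \ {b, τ}).card + (if τ ∈ V then 1 else 0) + (if b ∈ V then 1 else 0) = V.card := by
  have h1 : V \ {b, τ} = (V.erase b).erase τ := by
    ext x
    simp only [Finset.mem_sdiff, Finset.mem_insert, Finset.mem_singleton, Finset.mem_erase]
    tauto
  rw [h1]
  split_ifs with h2 h3 h3
  · rw [Finset.card_erase_add_one (Finset.mem_erase.2 ⟨hbτ.symm, h2⟩), Finset.card_erase_add_one h3]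
  · rw [add_zero, Finset.card_erase_add_one (Finset.mem_erase.2 ⟨hbτ.symm, h2⟩),
      Finset.erase_eq_of_notMem h3]
  · rw [add_zero, Finset.erase_eq_of_notMem (s := V.erase b) fun h => h2 (Finset.mem_of_mem_erase h),
      Finset.card_erase_add_one h3]
  · rw [add_zero, Finset.erase_eq_of_notMem (s := V.erase b) fun h => h2 (Finset.mem_of_mem_erase h),
      Finset.erase_eq_of_notMem h3, add_zero]

variable {σ : Type*} [Fintype σ] [DecidableEq σ]

open Classical in
/-- The number of steps in which the current `w`-face dies. -/
noncomputable def numDeaths (q : MvPolynomial σ ℝ) (d : ℕ) (w : σ → ℕ) : ℕ :=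
  ((Finset.range d).filter fun j => ¬ Survives q w j).card

open Classical in
/-- Whether the row of `q` in degree `j` has an entry at position `b`. -/
noncomputable def rowHits (q : MvPolynomial σ ℝ) (w : σ → ℕ) (k : σ) (j b : ℕ) : ℕ :=
  if ∃ α, q.coeff α ≠ 0 ∧ α.degree = j ∧ wt w α = minWt q w j ∧ α k = b then 1 else 0

theorem rowHits_le_one (q : MvPolynomial σ ℝ) (w : σ → ℕ) (k : σ) (j b : ℕ) :
    rowHits q w k j b ≤ 1 := by
  rw [rowHits]; split_ifs <;> simp

namespace IsHyperplanePair

variable {p q : MvPolynomial σ ℝ} {d : ℕ} (h : IsHyperplanePair p q d)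
include h

theorem rowLen_end (w : σ → ℕ) (k : σ) : rowLen q w k d = 1 := by
  have h1 : rowSeq q w k d (minWt q w d) = fun _ => 0 := by
    funext t
    by_contra h0
    obtain ⟨α, h1, h2, _⟩ := exists_of_rowSeq_ne_zero h0
    have := h.degree_lt h1
    omega
  have h2 : altLen (fun _ => 0) ≤ 0 := by
    have := (altChain_altLen (a := fun _ => 0) (V := ∅) (by simp)).le_card (V := ∅)
      (by simp [twist])
    simpa using this
  rw [rowLen, h1]
  omega

theorem rowHits_end (w : σ → ℕ) (k : σ) (b : ℕ) : rowHits q w k d b = 0 := by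
  rw [rowHits, if_neg]
  rintro ⟨α, h1, h2, _⟩
  have := h.degree_lt h1
  omega

open Classical in
/-- The two-dimensional case: every step gains a sign alternation in the row, every term of `p`
costs two, and killing the row costs one term for each alternation. -/
theorem add_numDeaths_le_card_of_edge {w : σ → ℕ} {i k : σ} (hw : IsEdgeWeight d w i k) :
    d + 3 * numDeaths q d w ≤ 2 * ∑ j ∈ Finset.range d, (faceTerms p q w j).card := by
  have key : ∀ j < d, rowLen q w k j + 1 + (if ¬ Survives q w j then 3 else 0) ≤
      rowLen q w k (j + 1) + 2 * (faceTerms p q w j).card := by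
    intro j hj
    rw [← h.card_rowTerms hw hj]
    by_cases hs : Survives q w j
    · have hcd : ∀ α : σ →₀ ℕ, α.degree ≤ d → 0 ≤ α k ∧ α k < d + 1 := fun α hα => by
        have := apply_le_degree α k
        omega
      have h1 := h.rowLen_alive hw hj hs (b := 0) (τ := d + 1)
        (fun α _ h2 _ => hcd α (by omega))
        (fun α _ h2 _ => ⟨Nat.zero_le _, (hcd α (by omega)).2.le⟩)
      have h2 := card_sdiff_pair (rowTerms p q w k j) (show 0 ≠ d + 1 by omega)
      have h3 : (if 0 ∈ rowTerms p q w k j ∧ rowSeq q w k (j + 1) (minWt q w j) 0 = 0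
          then 1 else 0) ≤ if 0 ∈ rowTerms p q w k j then 1 else 0 := by
        split_ifs <;> simp_all
      rw [if_neg (not_not.2 hs)]
      omega
    · have h1 := h.rowLen_dead hw hj hs
      have h2 : 1 ≤ rowLen q w k j := le_max_left _ _
      have h3 : 1 ≤ rowLen q w k (j + 1) := le_max_left _ _
      rw [if_pos hs]
      omega
  have hsum : ∀ m ≤ d, rowLen q w k 0 + m +
      ∑ j ∈ Finset.range m, (if ¬ Survives q w j then 3 else 0) ≤
      rowLen q w k m + ∑ j ∈ Finset.range m, 2 * (faceTerms p q w j).card := by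
    intro m hm
    induction m with
    | zero => simp
    | succ m ih =>
      have h1 := ih (by omega)
      have h2 := key m (by omega)
      rw [Finset.sum_range_succ, Finset.sum_range_succ]
      omega
  have h1 := hsum d le_rfl
  have h2 : 1 ≤ rowLen q w k 0 := le_max_left _ _
  rw [h.rowLen_end, ← Finset.mul_sum, ← Finset.sum_filter, Finset.sum_const] at h1
  rw [numDeaths]
  simp only [smul_eq_mul] at h1
  omega

/-- One step of a row whose bottom end is compared with a moving floor `b`. Terms on the floor are
not counted on the right. The potential `rowLen - rowHits` pays for them: as long as the row and
the floor persist, an entry on the floor is killed at most once. The number `e` accounts for a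
change of floor. -/
theorem rowLen_step {w : σ → ℕ} {i k : σ} (hw : IsEdgeWeight d w i k) {j : ℕ} (hj : j < d)
    {b b' τ e : ℕ}
    (hb : ∀ α, q.coeff α ≠ 0 → α.degree = j → wt w α = minWt q w j → b ≤ α k ∧ α k < τ)
    (hb' : ∀ α, q.coeff α ≠ 0 → α.degree = j + 1 → wt w α = minWt q w j → b ≤ α k ∧ α k ≤ τ)
    (he : Survives q w j → e = 0 → b' = b) :
    rowLen q w k j + 1 + rowHits q w k (j + 1) b' + (if j + 1 = d then 1 else 0) ≤
      rowLen q w k (j + 1) + rowHits q w k j b + (2 * (rowTerms p q w k j \ {b, τ}).card +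
        if τ ∈ rowTerms p q w k j then 1 else 0) + e := by
  have hbτ : b ≠ τ := by
    obtain ⟨α, h1, h2, h3⟩ := h.exists_wt_eq_minWt w hj
    have := hb α h1 h2 h3
    omega
  -- what was just below the floor cannot contribute
  have hrec : rowSeq q w k (j + 1) (minWt q w j) b + rowSeq p w k (j + 1) (minWt q w j) b =
      rowSeq q w k j (minWt q w j) b := by
    rw [h.rowSeq_rec hw hj]
    split_ifs with h0
    · simp
    · rw [add_eq_left]
      by_contra hne
      obtain ⟨α, h1, h2, h3, h4⟩ := exists_of_rowSeq_ne_zero hne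
      have := hb α h1 h2 h3
      omega
  have hg := h.rowSeq_bot_nonneg hw fun α h1 h2 h3 => (hb' α h1 h2 h3).1
  have hv := h.rowSeq_nonneg w k (j + 1) (minWt q w j) b
  have hhit : rowSeq q w k j (minWt q w j) b ≠ 0 → rowHits q w k j b = 1 := fun h0 => by
    rw [rowHits, if_pos]
    obtain ⟨α, h1⟩ := exists_of_rowSeq_ne_zero h0
    exact ⟨α, h1⟩
  have hmem := h.mem_rowTerms hw hj b
  have hkill : (if b ∈ rowTerms p q w k j ∧ rowSeq q w k (j + 1) (minWt q w j) b = 0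
      then 1 else 0) ≤ rowHits q w k j b := by
    split_ifs with h0
    · rw [hhit]
      rw [← hrec, h0.2, zero_add]
      exact hmem.1 h0.1
    · exact Nat.zero_le _
  have h1' := rowHits_le_one q w k (j + 1) b'
  by_cases hs : Survives q w j
  · have h1 := h.rowLen_alive hw hj hs hb hb'
    have h2 := h.lt_of_survives hs
    rw [if_neg (show j + 1 ≠ d by omega)]
    rcases Nat.eq_zero_or_pos e with he0 | he0
    · rw [he hs he0]
      have h3 : (if b ∈ rowTerms p q w k j ∧ rowSeq q w k (j + 1) (minWt q w j) b = 0
          then 1 else 0) + rowHits q w k (j + 1) b ≤ rowHits q w k j b := by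
        by_cases h4 : rowSeq q w k (j + 1) (minWt q w j) b = 0
        · have h5 : rowHits q w k (j + 1) b = 0 := by
            rw [rowHits, if_neg]
            rintro ⟨α, h5, h6, h7, h8⟩
            rw [h.minWt_succ_of_survives hw.separates ((hw.eq_zero_iff i).2 (Or.inl rfl)) hs]
              at h7
            refine h5 ?_
            rw [← hw.rowSeq_apply q (h.degree_lt h5).le, h6, h7, h8, h4]
          omega
        · rw [if_neg fun h5 => h4 h5.2, hhit]
          · have := rowHits_le_one q w k (j + 1) b
            omega
          · rw [← hrec]
            have := lt_of_le_of_ne hg (Ne.symm h4)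
            linarith
      omega
    · omega
  · have h1 := h.rowLen_dead hw hj hs
    have h2 := card_sdiff_pair (rowTerms p q w k j) hbτ
    have h3 : (if b ∈ rowTerms p q w k j then 1 else 0) ≤ rowHits q w k j b := by
      split_ifs with h0
      · rw [hhit]
        have := lt_of_le_of_ne hv (Ne.symm (hmem.1 h0))
        linarith
      · exact Nat.zero_le _
    have h4 : 1 ≤ rowLen q w k (j + 1) := le_max_left _ _
    by_cases h5 : j + 1 = d
    · have h6 : rowHits q w k (j + 1) b' = 0 := h5 ▸ h.rowHits_end w k b'
      rw [if_pos h5]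
      omega
    · rw [if_neg h5]
      omega

end IsHyperplanePair

/-- When only three coordinates are weightless, their sum is determined by the degree and the
weight. -/
theorem Separates.sum_three {d : ℕ} {w : σ → ℕ} (hsep : Separates d w) {i i' k : σ} (hii : i ≠ i')
    (hik : i ≠ k) (hik' : i' ≠ k) (hz : ∀ r, w r = 0 → r = i ∨ r = i' ∨ r = k) {α β : σ →₀ ℕ}
    (hα : α.degree ≤ d) (hβ : β.degree ≤ d) (hw : wt w α = wt w β) :
    α i + α i' + α k + β.degree = β i + β i' + β k + α.degree := by
  have h1 : ∀ γ : σ →₀ ℕ, γ.degree = γ i + γ i' + γ k + ∑ r ∈ Finset.univ \ {i, i', k}, γ r := by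
    intro γ
    rw [degree_eq_sum, ← Finset.sum_sdiff (Finset.subset_univ {i, i', k}), add_comm,
      Finset.sum_insert (by simp [hii, hik]), Finset.sum_insert (by simp [hik']),
      Finset.sum_singleton]
    ring
  have h2 : ∑ r ∈ Finset.univ \ {i, i', k}, α r = ∑ r ∈ Finset.univ \ {i, i', k}, β r := by
    refine Finset.sum_congr rfl fun r hr => hsep α β hα hβ hw r fun h0 => ?_
    simp only [Finset.mem_sdiff, Finset.mem_insert, Finset.mem_singleton] at hr
    exact hr.2 (hz r h0)
  have h3 := h1 α
  have h4 := h1 β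
  omega

namespace IsHyperplanePair

variable {p q : MvPolynomial σ ℝ} {d : ℕ} (h : IsHyperplanePair p q d)
include h

/-- A term of the `w`-face has the least possible `k`-th coordinate, and then it belongs to the face
of the refined weight, or it lies above this floor. -/
theorem card_faceTerms_refine {w : σ → ℕ} (k : σ) {j : ℕ} (hj : j < d) :
    (faceTerms p q w j).card = (faceTerms p q (refine d w k) j).card +
      ((faceTerms p q w j).filter fun α => α k ≠ minCoord q d w k j).card := by
  rw [← Finset.card_filter_add_card_filter_not (fun α => α k = minCoord q d w k j)]
  congr 2
  ext α
  rw [Finset.mem_filter, mem_faceTerms, mem_faceTerms]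
  constructor
  · rintro ⟨⟨h1, h2, h3⟩, h4⟩
    exact ⟨h1, h2, (h.wt_refine_eq_minWt_iff k hj (by omega)).2 ⟨h3, h4⟩⟩
  · rintro ⟨h1, h2, h3⟩
    have := (h.wt_refine_eq_minWt_iff k hj (by omega)).1 h3
    exact ⟨⟨h1, h2, this.1⟩, this.2⟩

/-- The rows in the direction `k` on the two sides of a triangular face are disjoint except for the
corner `τ` above the floor `b`. Weighting a term by two, and the corner by one in each of the rows,
the terms of both rows above the floor are therefore counted at most twice. -/
theorem two_views_card_le {φ χ : σ → ℕ} (hχφ : Refines d χ φ) {i i' k : σ} {j : ℕ} (hj : j < d)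
    {b τ C : ℕ} (hbτ : b < τ)
    (hC : ∀ α : σ →₀ ℕ, α.degree = j + 1 → wt χ α = minWt q χ j → α i + α i' + α k = C)
    (hτ : τ + minCoord q d χ i j + minCoord q d χ i' j = C)
    (hv : IsEdgeWeight d (refine d χ i') i k) (hv' : IsEdgeWeight d (refine d χ i) i' k) :
    (2 * (rowTerms p q (refine d χ i') k j \ {b, τ}).card +
        if τ ∈ rowTerms p q (refine d χ i') k j then 1 else 0) +
      (2 * (rowTerms p q (refine d χ i) k j \ {b, τ}).card +
        if τ ∈ rowTerms p q (refine d χ i) k j then 1 else 0) ≤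
      2 * ((faceTerms p q φ j).filter fun α => α k ≠ b).card := by
  have hmem : ∀ {x y : σ} (_ : IsEdgeWeight d (refine d χ x) y k) (α : σ →₀ ℕ),
      α ∈ faceTerms p q (refine d χ x) j ↔ p.coeff α ≠ 0 ∧ α.degree = j + 1 ∧
        wt χ α = minWt q χ j ∧ α x = minCoord q d χ x j := by
    intro x y _ α
    rw [mem_faceTerms]
    constructor
    · rintro ⟨h1, h2, h3⟩
      exact ⟨h1, h2, (h.wt_refine_eq_minWt_iff x hj (by omega)).1 h3⟩
    · rintro ⟨h1, h2, h3⟩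
      exact ⟨h1, h2, (h.wt_refine_eq_minWt_iff x hj (by omega)).2 h3⟩
  -- positions in a row correspond to terms
  have hcard : ∀ {x y : σ} (_ : IsEdgeWeight d (refine d χ x) y k),
      (rowTerms p q (refine d χ x) k j \ {b, τ}).card =
        ((faceTerms p q (refine d χ x) j).filter fun α => α k ≠ b ∧ α k ≠ τ).card := by
    intro x y hw
    rw [← Finset.card_image_of_injOn (f := fun α : σ →₀ ℕ => α k)]
    · congr 1
      ext t
      simp only [rowTerms, Finset.mem_sdiff, Finset.mem_image, Finset.mem_insert,
        Finset.mem_singleton, Finset.mem_filter, not_or]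
      constructor
      · rintro ⟨⟨α, h1, rfl⟩, h2⟩
        exact ⟨α, ⟨h1, h2⟩, rfl⟩
      · rintro ⟨α, ⟨h1, h2⟩, rfl⟩
        exact ⟨⟨α, h1, rfl⟩, h2⟩
    · intro α hα β hβ hab
      simp only [Finset.coe_filter, Set.mem_ofPred_eq, mem_faceTerms] at hα hβ
      exact hw.separates.eq_of_edge (fun r hr => (hw.eq_zero_iff r).1 hr) (by omega)
        (hα.1.2.1.trans hβ.1.2.1.symm) (hα.1.2.2.trans hβ.1.2.2.symm) hab
  set U := (faceTerms p q (refine d χ i') j).filter fun α => α k ≠ b ∧ α k ≠ τ with hU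
  set U' := (faceTerms p q (refine d χ i) j).filter fun α => α k ≠ b ∧ α k ≠ τ with hU'
  -- the corner shared by the two rows
  set W := (faceTerms p q (refine d χ i') j).filter fun α => α k = τ with hW
  have hW' : W = (faceTerms p q (refine d χ i) j).filter fun α => α k = τ := by
    ext α
    rw [Finset.mem_filter, Finset.mem_filter, hmem hv, hmem hv']
    constructor
    · rintro ⟨⟨h1, h2, h3, h4⟩, h5⟩
      have := hC α h2 h3
      exact ⟨⟨h1, h2, h3, by omega⟩, h5⟩
    · rintro ⟨⟨h1, h2, h3, h4⟩, h5⟩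
      have := hC α h2 h3
      exact ⟨⟨h1, h2, h3, by omega⟩, h5⟩
  have hWc : (if τ ∈ rowTerms p q (refine d χ i') k j then 1 else 0) ≤ W.card := by
    split_ifs with h0
    · obtain ⟨α, h1, h2⟩ := Finset.mem_image.1 h0
      exact Finset.card_pos.2 ⟨α, Finset.mem_filter.2 ⟨h1, h2⟩⟩
    · exact Nat.zero_le _
  have hWc' : (if τ ∈ rowTerms p q (refine d χ i) k j then 1 else 0) ≤ W.card := by
    split_ifs with h0
    · obtain ⟨α, h1, h2⟩ := Finset.mem_image.1 h0
      exact Finset.card_pos.2 ⟨α, hW' ▸ Finset.mem_filter.2 ⟨h1, h2⟩⟩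
    · exact Nat.zero_le _
  have hd1 : Disjoint U U' := by
    rw [Finset.disjoint_left]
    intro α h1 h2
    rw [hU, Finset.mem_filter, hmem hv] at h1
    rw [hU', Finset.mem_filter, hmem hv'] at h2
    have := hC α h1.1.2.1 h1.1.2.2.1
    have := h1.1.2.2.2
    have := h2.1.2.2.2
    have := h1.2.2
    omega
  have hd2 : Disjoint (U ∪ U') W := by
    rw [Finset.disjoint_left]
    intro α h1 h2
    have h3 := (Finset.mem_filter.1 h2).2
    rcases Finset.mem_union.1 h1 with h1 | h1
    · exact (Finset.mem_filter.1 h1).2.2 h3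
    · exact (Finset.mem_filter.1 h1).2.2 h3
  have hsub : (U ∪ U') ∪ W ⊆ (faceTerms p q φ j).filter fun α => α k ≠ b := by
    have aux : ∀ {x y : σ} (_ : IsEdgeWeight d (refine d χ x) y k) (α : σ →₀ ℕ),
        α ∈ faceTerms p q (refine d χ x) j → α ∈ faceTerms p q φ j := by
      intro x y hw α hα
      rw [hmem hw] at hα
      rw [mem_faceTerms]
      exact ⟨hα.1, hα.2.1, h.wt_eq_minWt_of_refines hχφ hj (by omega) hα.2.2.1⟩
    intro α hα
    rw [Finset.mem_filter]
    rcases Finset.mem_union.1 hα with hα | hα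
    · rcases Finset.mem_union.1 hα with hα | hα
      · have := Finset.mem_filter.1 hα
        exact ⟨aux hv α this.1, this.2.1⟩
      · have := Finset.mem_filter.1 hα
        exact ⟨aux hv' α this.1, this.2.1⟩
    · have := Finset.mem_filter.1 hα
      exact ⟨aux hv α this.1, by omega⟩
  have h1 := Finset.card_le_card hsub
  rw [Finset.card_union_of_disjoint hd2, Finset.card_union_of_disjoint hd1] at h1
  rw [hcard hv, hcard hv', ← hU, ← hU']
  omega

open Classical in
/-- There is at least one term off the floor for each step, not counting the steps at which the floor
dies but the face survives. Two rows that climb from the floor in the direction `k`, towards a common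
corner, are followed; the corner is an end of both rows, so that every term counts at most twice. -/
theorem le_card_off_floor {φ : σ → ℕ} (hsep : Separates d φ) {i i' k : σ} (hii : i ≠ i')
    (hik : i ≠ k) (hik' : i' ≠ k) (hi : φ i = 0) (hi' : φ i' = 0) (hk : φ k = 0) :
    d + numDeaths q d φ ≤ numDeaths q d (refine d φ k) + ∑ j ∈ Finset.range d,
      ((faceTerms p q φ j).filter fun α => α k ≠ minCoord q d φ k j).card := by
  obtain ⟨χ, hχ, hχφ, hχz⟩ := hsep.exists_refines (Finset.univ \ {i, i', k})
  have hz : ∀ r, χ r = 0 ↔ r = i ∨ r = i' ∨ r = k := by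
    intro r
    rw [hχz]
    simp only [Finset.mem_sdiff, Finset.mem_univ, true_and, not_not, Finset.mem_insert,
      Finset.mem_singleton]
    constructor
    · exact fun h => h.2
    · rintro (rfl | rfl | rfl) <;> simp [*]
  have hv : IsEdgeWeight d (refine d χ i') i k :=
    ⟨hχ.refine i', fun r => by
      rw [refine_eq_zero, hz]
      constructor
      · tauto
      · rintro (rfl | rfl) <;> simp [hii, hik'.symm], hik⟩
  have hv' : IsEdgeWeight d (refine d χ i) i' k :=
    ⟨hχ.refine i, fun r => by
      rw [refine_eq_zero, hz]
      constructor
      · tauto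
      · rintro (rfl | rfl) <;> simp [hii.symm, hik.symm], hik'⟩
  set e : ℕ → ℕ := fun j => if Survives q φ j ∧ ¬ Survives q (refine d φ k) j then 1 else 0 with he
  set b : ℕ → ℕ := fun j => minCoord q d φ k j with hb
  have step : ∀ j < d,
      (rowLen q (refine d χ i') k j + rowLen q (refine d χ i) k j + 2) +
        (rowHits q (refine d χ i') k (j + 1) (b (j + 1)) +
          rowHits q (refine d χ i) k (j + 1) (b (j + 1))) + (if j + 1 = d then 2 else 0) ≤
      (rowLen q (refine d χ i') k (j + 1) + rowLen q (refine d χ i) k (j + 1)) +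
        (rowHits q (refine d χ i') k j (b j) + rowHits q (refine d χ i) k j (b j)) +
        2 * ((faceTerms p q φ j).filter fun α => α k ≠ b j).card + 2 * e j := by
    intro j hj
    obtain ⟨α₀, h1, h2, h3⟩ := h.exists_wt_eq_minWt χ hj
    have hα₀ := h.minCoord_le i h1 h2 h3
    have hα₀' := h.minCoord_le i' h1 h2 h3
    obtain ⟨C, hCdef⟩ : ∃ C, C = α₀ i + α₀ i' + α₀ k + 1 := ⟨_, rfl⟩
    obtain ⟨τ, hτ⟩ : ∃ τ, τ + minCoord q d χ i j + minCoord q d χ i' j = C :=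
      ⟨C - minCoord q d χ i j - minCoord q d χ i' j, by omega⟩
    have hC0 : ∀ α : σ →₀ ℕ, α.degree = j → wt χ α = minWt q χ j → α i + α i' + α k + 1 = C := by
      intro α h4 h5
      have := hχ.sum_three hii hik hik' (fun r => (hz r).1) (α := α) (β := α₀) (by omega)
        (by omega) (h5.trans h3.symm)
      omega
    have hC1 : ∀ α : σ →₀ ℕ, α.degree = j + 1 → wt χ α = minWt q χ j →
        α i + α i' + α k = C := by
      intro α h4 h5
      have := hχ.sum_three hii hik hik' (fun r => (hz r).1) (α := α) (β := α₀) (by omega)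
        (by omega) (h5.trans h3.symm)
      omega
    have hbnd : ∀ {x y : σ}, IsEdgeWeight d (refine d χ x) y k →
        (∀ α : σ →₀ ℕ, α x = minCoord q d χ x j → minCoord q d χ y j ≤ α y →
          (α i + α i' + α k + 1 = C → α k < τ) ∧ (α i + α i' + α k = C → α k ≤ τ)) →
        (χ x = 0) → (x ≠ y) →
        (∀ α, q.coeff α ≠ 0 → α.degree = j → wt (refine d χ x) α = minWt q (refine d χ x) j →
          b j ≤ α k ∧ α k < τ) ∧
        (∀ α, q.coeff α ≠ 0 → α.degree = j + 1 → wt (refine d χ x) α = minWt q (refine d χ x) j →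
          b j ≤ α k ∧ α k ≤ τ) := by
      intro x y hw hxy hx hne
      constructor
      · intro α h4 h5 h6
        have h7 := (h.wt_refine_eq_minWt_iff x hj (by omega)).1 h6
        exact ⟨h.minCoord_le k h4 h5 (h.wt_eq_minWt_of_refines hχφ hj (by omega) h7.1),
          (hxy α h7.2 (h.minCoord_le y h4 h5 h7.1)).1 (hC0 α h5 h7.1)⟩
      · intro α h4 h5 h6
        have h7 := (h.wt_refine_eq_minWt_iff x hj (by omega)).1 h6
        exact ⟨h.minCoord_le_succ hsep hi hik hj h5 (Or.inl h4)
            (h.wt_eq_minWt_of_refines hχφ hj (by omega) h7.1),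
          (hxy α h7.2 (h.minCoord_le_succ hχ hx hne hj h5 (Or.inl h4) h7.1)).2 (hC1 α h5 h7.1)⟩
    have hfloor : ∀ x : σ, Survives q (refine d χ x) j → e j = 0 → b (j + 1) = b j := by
      intro x hs he0
      have h4 := h.survives_of_refines hχφ hj (h.survives_of_refines (refines_refine d χ x) hj hs)
      have h5 : Survives q (refine d φ k) j := by
        by_contra h5
        simp [he, h4, h5] at he0
      exact h.minCoord_succ_of_survives hsep hi hik hj h5
    have hB := hbnd hv (fun α h4 h5 => ⟨fun h6 => by omega, fun h6 => by omega⟩)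
      ((hz i').2 (by simp)) hii.symm
    have hB' := hbnd hv' (fun α h4 h5 => ⟨fun h6 => by omega, fun h6 => by omega⟩)
      ((hz i).2 (by simp)) hii
    have hs1 := h.rowLen_step hv hj hB.1 hB.2 (hfloor i')
    have hs2 := h.rowLen_step hv' hj hB'.1 hB'.2 (hfloor i)
    have hbτ : b j < τ := by
      obtain ⟨α, h4, h5, h6⟩ := h.exists_wt_eq_minWt (refine d χ i') hj
      have := hB.1 α h4 h5 h6
      omega
    have h8 := h.two_views_card_le hχφ hj hbτ hC1 hτ hv hv'
    by_cases h9 : j + 1 = d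
    · rw [if_pos h9] at hs1 hs2 ⊢
      omega
    · rw [if_neg h9] at hs1 hs2 ⊢
      omega
  have hsum : ∀ m ≤ d,
      (rowLen q (refine d χ i') k 0 + rowLen q (refine d χ i) k 0 + 2 * m) +
        (rowHits q (refine d χ i') k m (b m) +
          rowHits q (refine d χ i) k m (b m)) + (if m = d then 2 else 0) ≤
      (rowLen q (refine d χ i') k m + rowLen q (refine d χ i) k m) +
        (rowHits q (refine d χ i') k 0 (b 0) + rowHits q (refine d χ i) k 0 (b 0)) +
        2 * (∑ j ∈ Finset.range m,
          ((faceTerms p q φ j).filter fun α => α k ≠ b j).card) +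
        2 * ∑ j ∈ Finset.range m, e j := by
    intro m hm
    induction m with
    | zero =>
      have := h.one_le
      rw [if_neg (by omega)]
      simp
    | succ m ih =>
      have h1 := ih (by omega)
      have h2 := step m (by omega)
      rw [if_neg (show m ≠ d by omega)] at h1
      rw [Finset.sum_range_succ, Finset.sum_range_succ]
      omega
  have h1 := hsum d le_rfl
  rw [if_pos rfl, h.rowLen_end, h.rowLen_end, h.rowHits_end, h.rowHits_end] at h1
  have h2 : 1 ≤ rowLen q (refine d χ i') k 0 := le_max_left _ _
  have h3 : 1 ≤ rowLen q (refine d χ i) k 0 := le_max_left _ _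
  have h4 := rowHits_le_one q (refine d χ i') k 0 (b 0)
  have h5 := rowHits_le_one q (refine d χ i) k 0 (b 0)
  have h6 : ∑ j ∈ Finset.range d, e j + numDeaths q d φ = numDeaths q d (refine d φ k) := by
    rw [numDeaths, numDeaths, he, ← Finset.card_filter, ← Finset.card_union_of_disjoint]
    · congr 1
      ext j
      simp only [Finset.mem_union, Finset.mem_filter, Finset.mem_range]
      have : j < d → Survives q (refine d φ k) j → Survives q φ j := fun hj hs =>
        h.survives_of_refines (refines_refine d φ k) hj hs
      tauto
    · rw [Finset.disjoint_left]
      intro j h7 h8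
      simp only [Finset.mem_filter] at h7 h8
      tauto
  change d + _ ≤ _ + ∑ j ∈ Finset.range d,
    ((faceTerms p q φ j).filter fun α => α k ≠ b j).card
  omega

/-- Induction on the number `m + 2` of weightless variables. -/
theorem add_numDeaths_le_card (m : ℕ) {w : σ → ℕ} (hsep : Separates d w)
    (hm : (Finset.univ.filter fun r => w r = 0).card = m + 2) :
    (2 * m + 1) * d + 3 * numDeaths q d w ≤
      2 * ∑ j ∈ Finset.range d, (faceTerms p q w j).card := by
  induction m generalizing w with
  | zero =>
    obtain ⟨i, k, hik, hw⟩ := Finset.card_eq_two.1 hm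
    have := h.add_numDeaths_le_card_of_edge (w := w) (i := i) (k := k)
      ⟨hsep, fun r => by simpa using Finset.ext_iff.1 hw r, hik⟩
    simpa using this
  | succ m ih =>
    obtain ⟨i, hi, i', hi', k, hk, hii, hik, hik'⟩ :=
      Finset.two_lt_card.1 (show 2 < (Finset.univ.filter fun r => w r = 0).card by omega)
    simp only [Finset.mem_filter, Finset.mem_univ, true_and] at hi hi' hk
    have h1 := h.le_card_off_floor hsep hii hik hik' hi hi' hk
    have h2 := ih (w := BallMaps.refine d w k) (hsep.refine k) (by
      have h3 : (Finset.univ.filter fun r => BallMaps.refine d w k r = 0) =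
          (Finset.univ.filter fun r => w r = 0).erase k := by
        ext r
        simp only [Finset.mem_filter, Finset.mem_univ, true_and, refine_eq_zero, Finset.mem_erase]
        tauto
      rw [h3, Finset.card_erase_of_mem (by simpa using hk), hm]
      rfl)
    have h3 : ∑ j ∈ Finset.range d, (faceTerms p q w j).card =
        ∑ j ∈ Finset.range d, (faceTerms p q (BallMaps.refine d w k) j).card +
        ∑ j ∈ Finset.range d,
          ((faceTerms p q w j).filter fun α => α k ≠ minCoord q d w k j).card := by
      rw [← Finset.sum_add_distrib]
      exact Finset.sum_congr rfl fun j hj => h.card_faceTerms_refine k (Finset.mem_range.1 hj)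
    have h4 : numDeaths q d w ≤ numDeaths q d (BallMaps.refine d w k) := by
      classical
      rw [numDeaths, numDeaths]
      refine Finset.card_le_card fun j => ?_
      simp only [Finset.mem_filter, Finset.mem_range]
      exact fun h5 => ⟨h5.1, fun h6 =>
        h5.2 (h.survives_of_refines (refines_refine d w k) h5.1 h6)⟩
    rw [h3]
    have h5 : (2 * (m + 1) + 1) * d = (2 * m + 1) * d + 2 * d := by ring
    omega

/-- A polynomial of degree `d ≥ 1` in `n ≥ 2` variables with `N` terms and nonnegative coefficients
that equals `1` on the hyperplane `∑ xᵢ = 1` satisfies `(2n - 3) d + 3 ≤ 2N`. -/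
theorem degree_bound {m : ℕ} (hm : Fintype.card σ = m + 2) :
    (2 * m + 1) * d + 3 ≤ 2 * p.support.card := by
  classical
  have h1 := h.add_numDeaths_le_card m (separates_zero d) (by simpa using hm)
  have h2 : 1 ≤ numDeaths q d 0 := by
    refine Finset.card_pos.2 ⟨d - 1, ?_⟩
    have := h.one_le
    simp only [Finset.mem_filter, Finset.mem_range]
    exact ⟨by omega, fun hs => by have := h.lt_of_survives hs; omega⟩
  have h3 : ∑ j ∈ Finset.range d, (faceTerms p q 0 j).card ≤ p.support.card := by
    rw [← Finset.card_biUnion]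
    · exact Finset.card_le_card (Finset.biUnion_subset.2 fun j _ => Finset.filter_subset _ _)
    · intro j _ j' _ hne
      rw [Function.onFun, Finset.disjoint_left]
      intro α h4 h5
      rw [mem_faceTerms] at h4 h5
      exact hne (by omega)
  omega

end IsHyperplanePair

end BallMaps

/-! ### Polynomials on the simplex -/

namespace BallMaps

open MvPolynomial

section Simplex

variable {σ : Type*}

theorem eq_zero_of_eval_pos {r : MvPolynomial σ ℝ} (hr : ∀ α, 0 ≤ r.coeff α) {x : σ → ℝ}
    (hx : ∀ i, 0 < x i) (h0 : eval x r = 0) : r = 0 := by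
  rw [eval_eq, Finset.sum_eq_zero_iff_of_nonneg fun α _ =>
    mul_nonneg (hr α) (Finset.prod_nonneg fun i _ => pow_nonneg (hx i).le _)] at h0
  rw [← support_eq_empty, Finset.eq_empty_iff_forall_notMem]
  intro α hα
  have h1 := h0 α hα
  have h2 : 0 < ∏ i ∈ α.support, x i ^ α i := Finset.prod_pos fun i _ => pow_pos (hx i) _
  exact mem_support_iff.1 hα ((mul_eq_zero.1 h1).resolve_right h2.ne')

variable [Fintype σ]

/-- A polynomial that vanishes on the standard simplex is a multiple of `1 - ∑ xᵢ`. -/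
theorem dvd_of_eval_simplex [Nonempty σ] {r : MvPolynomial σ ℝ}
    (hr : ∀ x : σ → ℝ, (∀ i, 0 ≤ x i) → ∑ i, x i = 1 → eval x r = 0) :
    (1 - ∑ i, X i) ∣ r := by
  classical
  obtain ⟨i₀⟩ := ‹Nonempty σ›
  -- eliminate one variable with the equation of the hyperplane
  set θ : MvPolynomial σ ℝ →ₐ[ℝ] MvPolynomial σ ℝ :=
    aeval fun i => if i = i₀ then 1 - ∑ j ∈ Finset.univ.erase i₀, X j else X i with hθ
  have h1 : θ r = 0 := by
    have hcard : (0 : ℝ) < Fintype.card σ := by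
      have : 0 < Fintype.card σ := Fintype.card_pos_iff.2 ⟨i₀⟩
      exact_mod_cast this
    refine funext_set (fun _ => Set.Icc 0 (1 / (Fintype.card σ : ℝ)))
      (fun _ => Set.Icc_infinite (by positivity)) fun x hx => ?_
    have hx' : ∀ i, 0 ≤ x i ∧ x i ≤ 1 / (Fintype.card σ : ℝ) := fun i => hx i (Set.mem_univ i)
    rw [map_zero, hθ, aeval_def, eval₂_eq, map_sum]
    have h2 := hr (fun i => if i = i₀ then 1 - ∑ j ∈ Finset.univ.erase i₀, x j else x i) ?_ ?_
    · rw [← h2, eval_eq]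
      refine Finset.sum_congr rfl fun m _ => ?_
      simp only [map_mul, map_prod, map_pow, apply_ite (eval x), map_sub, map_one, map_sum, eval_X]
      simp
    · intro i
      split_ifs
      · have h3 : ∑ j ∈ Finset.univ.erase i₀, x j ≤ ∑ j, x j :=
          Finset.sum_le_sum_of_subset_of_nonneg (Finset.erase_subset _ _) fun j _ _ => (hx' j).1
        have h4 : ∑ j, x j ≤ ∑ _j : σ, 1 / (Fintype.card σ : ℝ) :=
          Finset.sum_le_sum fun j _ => (hx' j).2
        rw [Finset.sum_const, Finset.card_univ, nsmul_eq_mul, mul_one_div_cancel hcard.ne'] at h4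
        linarith
      · exact (hx' i).1
    · rw [← Finset.add_sum_erase _ _ (Finset.mem_univ i₀), if_pos rfl,
        Finset.sum_congr rfl fun j hj => if_neg (Finset.ne_of_mem_erase hj)]
      ring
  set I : Ideal (MvPolynomial σ ℝ) := Ideal.span {1 - ∑ i, X i} with hI
  have h2 : (Ideal.Quotient.mkₐ ℝ I).comp θ = Ideal.Quotient.mkₐ ℝ I := by
    refine algHom_ext fun i => ?_
    rw [AlgHom.comp_apply, hθ, aeval_X]
    split_ifs with h3
    · subst h3
      refine (Ideal.Quotient.mk_eq_mk_iff_sub_mem _ _).2 ?_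
      rw [hI, Ideal.mem_span_singleton, ← Finset.add_sum_erase _ _ (Finset.mem_univ i)]
      exact ⟨1, by ring⟩
    · rfl
  have h3 := congrArg (fun φ => φ r) h2
  simp only [AlgHom.comp_apply, h1, map_zero] at h3
  rw [← Ideal.mem_span_singleton, ← hI]
  exact Ideal.Quotient.eq_zero_iff_mem.1 h3.symm

/-- A polynomial with nonnegative coefficients in an affine family on the simplex may be moved
within the family, keeping its coefficients nonnegative and a given coefficient positive, until it
is as sparse as a vertex of the polytope of parameters: each of the `k` dimensions of the family
saves one of the terms available in the family. -/
theorem exists_sparse [Nonempty σ] {k : ℕ} {P : Fin (k + 1) → MvPolynomial σ ℝ}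
    (hP : LinearIndependent ℝ P)
    (hP1 : ∀ j, ∀ x : σ → ℝ, (∀ i, 0 ≤ x i) → ∑ i, x i = 1 → eval x (P j) = 1)
    {S : Finset (σ →₀ ℕ)} (hS : ∀ j, (P j).support ⊆ S) (α₀ : σ →₀ ℕ) (m : ℕ) :
    ∀ c : Fin (k + 1) → ℝ, ∑ j, c j = 1 → (∀ α, 0 ≤ (∑ j, c j • P j).coeff α) →
      0 < (∑ j, c j • P j).coeff α₀ → (∑ j, c j • P j).support.card = m →
      ∃ c' : Fin (k + 1) → ℝ, ∑ j, c' j = 1 ∧ (∀ α, 0 ≤ (∑ j, c' j • P j).coeff α) ∧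
        0 < (∑ j, c' j • P j).coeff α₀ ∧ (∑ j, c' j • P j).support.card + k ≤ S.card := by
  classical
  have hsupp : ∀ c : Fin (k + 1) → ℝ, ∀ α ∉ S, (∑ j, c j • P j).coeff α = 0 := fun c α hα => by
    rw [coeff_sum]
    refine Finset.sum_eq_zero fun j _ => ?_
    rw [coeff_smul, notMem_support_iff.1 fun h => hα (hS j h), smul_zero]
  induction m using Nat.strong_induction_on with
  | _ m ih =>
  intro c hc1 hc2 hc3 hm
  set p := ∑ j, c j • P j with hp
  by_cases hcard : p.support.card + k ≤ S.card
  · exact ⟨c, hc1, hc2, hc3, hcard⟩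
  have hpS : p.support ⊆ S := fun α hα => by
    by_contra h
    exact mem_support_iff.1 hα (hsupp c α h)
  set Z := S \ p.support with hZ
  have hZc : Z.card < k := by
    have := Finset.card_le_card hpS
    rw [hZ, Finset.card_sdiff_of_subset hpS]
    omega
  -- a direction of the family along which the vanishing coefficients of `p` stay zero
  obtain ⟨v, hv0, hv1, hvZ⟩ : ∃ v : Fin (k + 1) → ℝ, v ≠ 0 ∧ ∑ j, v j = 0 ∧
      ∀ β ∈ Z, (∑ j, v j • P j).coeff β = 0 := by
    let T : (Fin (k + 1) → ℝ) →ₗ[ℝ] ℝ × (Z → ℝ) :=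
      { toFun := fun v => (∑ j, v j, fun β => ∑ j, v j * (P j).coeff β.1)
        map_add' := fun v w => by
          ext <;> simp [Finset.sum_add_distrib, add_mul]
        map_smul' := fun a v => by
          ext <;> simp [Finset.mul_sum, mul_assoc] }
    have hT : LinearMap.ker T ≠ ⊥ := LinearMap.ker_ne_bot_of_finrank_lt (by
      simp; omega)
    obtain ⟨v, hv, hv0⟩ := Submodule.exists_mem_ne_zero_of_ne_bot hT
    have hv' : T v = 0 := hv
    refine ⟨v, hv0, congrArg Prod.fst hv', fun β hβ => ?_⟩
    have := congrFun (congrArg Prod.snd hv') ⟨β, hβ⟩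
    rw [coeff_sum]
    simpa [T, coeff_smul] using this
  obtain ⟨v, hv0, hv1, hvZ, hvα⟩ : ∃ v : Fin (k + 1) → ℝ, v ≠ 0 ∧ ∑ j, v j = 0 ∧
      (∀ β ∈ Z, (∑ j, v j • P j).coeff β = 0) ∧ 0 ≤ (∑ j, v j • P j).coeff α₀ := by
    rcases le_total 0 ((∑ j, v j • P j).coeff α₀) with h | h
    · exact ⟨v, hv0, hv1, hvZ, h⟩
    · have hneg : ∑ j, (-v) j • P j = - ∑ j, v j • P j := by simp
      refine ⟨-v, neg_ne_zero.2 hv0, by simp [hv1], fun β hβ => ?_, ?_⟩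
      · rw [hneg, coeff_neg, hvZ β hβ, neg_zero]
      · rw [hneg, coeff_neg]
        linarith
  set r := ∑ j, v j • P j with hr
  have hr0 : r ≠ 0 := fun h => hv0 (funext (Fintype.linearIndependent_iff.1 hP v h))
  -- `r` vanishes at the barycentre of the simplex, so it has a negative coefficient
  obtain ⟨β₀, hβ₀⟩ : ∃ β, r.coeff β < 0 := by
    by_contra! hnn
    have hcard : (0 : ℝ) < Fintype.card σ := by exact_mod_cast Fintype.card_pos
    refine hr0 (eq_zero_of_eval_pos hnn (x := fun _ => 1 / (Fintype.card σ : ℝ))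
      (fun _ => by positivity) ?_)
    rw [hr, map_sum, ← hv1]
    refine Finset.sum_congr rfl fun j _ => ?_
    rw [smul_eval, hP1 j _ (fun _ => by positivity), mul_one]
    rw [Finset.sum_const, Finset.card_univ, nsmul_eq_mul, mul_one_div_cancel hcard.ne']
  obtain ⟨β, hβ, hβmin⟩ := Finset.exists_min_image (r.support.filter fun β => r.coeff β < 0)
    (fun β => p.coeff β / (- r.coeff β)) ⟨β₀, by simp [hβ₀, hβ₀.ne]⟩
  simp only [Finset.mem_filter, mem_support_iff] at hβ hβmin
  set s := p.coeff β / (- r.coeff β) with hs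
  have hs0 : 0 ≤ s := div_nonneg (hc2 β) (by linarith [hβ.2])
  have hsum : ∑ j, (c j + s * v j) • P j = p + s • r := by
    rw [hp, hr, Finset.smul_sum, ← Finset.sum_add_distrib]
    exact Finset.sum_congr rfl fun j _ => by rw [add_smul, mul_smul]
  have hβ0 : (p + s • r).coeff β = 0 := by
    rw [coeff_add, coeff_smul, hs, smul_eq_mul, div_mul_eq_mul_div, div_neg,
      mul_div_cancel_right₀ _ hβ.1, add_neg_cancel]
  have hss : (p + s • r).support ⊂ p.support := by
    rw [Finset.ssubset_iff_of_subset]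
    · refine ⟨β, ?_, fun h => mem_support_iff.1 h hβ0⟩
      by_contra hβp
      refine hβ.1 (hvZ β (Finset.mem_sdiff.2 ⟨?_, hβp⟩))
      by_contra h
      exact hβ.1 (hsupp v β h)
    · intro γ hγ
      by_contra hγp
      refine mem_support_iff.1 hγ ?_
      have h1 : r.coeff γ = 0 := by
        by_cases h : γ ∈ S
        · exact hvZ γ (Finset.mem_sdiff.2 ⟨h, hγp⟩)
        · exact hsupp v γ h
      rw [coeff_add, coeff_smul, h1, notMem_support_iff.1 hγp, smul_zero, add_zero]
  refine ih _ (hm ▸ Finset.card_lt_card hss) (fun j => c j + s * v j) ?_ ?_ ?_ (by rw [hsum])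
  · rw [Finset.sum_add_distrib, ← Finset.mul_sum, hc1, hv1, mul_zero, add_zero]
  · intro γ
    rw [hsum, coeff_add, coeff_smul, smul_eq_mul]
    rcases lt_or_ge (r.coeff γ) 0 with h | h
    · have h1 := hβmin γ ⟨h.ne, h⟩
      rw [le_div_iff₀ (by linarith)] at h1
      linarith
    · exact add_nonneg (hc2 γ) (mul_nonneg hs0 h)
  · rw [hsum, coeff_add, coeff_smul, smul_eq_mul]
    exact add_pos_of_pos_of_nonneg hc3 (mul_nonneg hs0 hvα)

/-- The degree bound for the members of a `k`-dimensional affine family of polynomials equal to `1`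
on the simplex. -/
theorem family_degree_bound {k m : ℕ} (hm : Fintype.card σ = m + 2)
    {P : Fin (k + 1) → MvPolynomial σ ℝ} (hP : LinearIndependent ℝ P)
    (hP1 : ∀ j, ∀ x : σ → ℝ, (∀ i, 0 ≤ x i) → ∑ i, x i = 1 → eval x (P j) = 1)
    {S : Finset (σ →₀ ℕ)} (hS : ∀ j, (P j).support ⊆ S) {c : Fin (k + 1) → ℝ}
    (hc : ∑ j, c j = 1) (hcn : ∀ α, 0 ≤ (∑ j, c j • P j).coeff α)
    (hD : 1 ≤ (∑ j, c j • P j).totalDegree) :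
    (2 * m + 1) * (∑ j, c j • P j).totalDegree + 3 + 2 * k ≤ 2 * S.card := by
  classical
  have hne : Nonempty σ := Fintype.card_pos_iff.1 (by omega)
  set p := ∑ j, c j • P j with hp
  have hp0 : p.support.Nonempty := by
    rw [Finset.nonempty_iff_ne_empty]
    intro h0
    rw [support_eq_empty.1 h0, totalDegree_zero] at hD
    omega
  obtain ⟨α₀, hα₀, hα₀d⟩ := Finset.exists_mem_eq_sup p.support hp0 fun s => s.sum fun _ e => e
  obtain ⟨c', h1, h2, h3, h4⟩ := exists_sparse hP hP1 hS α₀ _ c hc hcn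
    (lt_of_le_of_ne (hcn α₀) (Ne.symm (mem_support_iff.1 hα₀))) rfl
  set p' := ∑ j, c' j • P j with hp'
  have h5 : p.totalDegree ≤ p'.totalDegree :=
    hα₀d.le.trans (le_totalDegree (mem_support_iff.2 h3.ne'))
  obtain ⟨q, hq⟩ : (1 - ∑ i, X i) ∣ 1 - p' := by
    refine dvd_of_eval_simplex fun x hx hx1 => ?_
    rw [map_sub, map_one, hp', map_sum, ← h1, ← Finset.sum_sub_distrib]
    refine Finset.sum_eq_zero fun j _ => ?_
    rw [smul_eval, hP1 j x hx hx1, mul_one, sub_self]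
  have h6 : IsHyperplanePair p' q p'.totalDegree := ⟨h2, hq, rfl, hD.trans h5⟩
  have h7 := h6.degree_bound hm
  have h8 := Nat.mul_le_mul_left (2 * m + 1) h5
  omega

end Simplex

end BallMaps

/-! ### Holomorphic maps of equal norm -/

namespace BallMaps

section Norms

open scoped InnerProductSpace

variable {E F : Type*} [NormedAddCommGroup E] [InnerProductSpace ℂ E]
  [NormedAddCommGroup F] [InnerProductSpace ℂ F]

theorem hasDerivAt_line {f : ℂ → E} {U : Set ℂ} (hU : IsOpen U) (hf : DifferentiableOn ℂ f U)
    {z v : ℂ} {t : ℝ} (ht : z + t * v ∈ U) :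
    HasDerivAt (fun t : ℝ => f (z + t * v)) (v • deriv f (z + t * v)) t := by
  have h1 : HasDerivAt f (deriv f (z + t * v)) (z + t * v) :=
    ((hf _ ht).differentiableAt (hU.mem_nhds ht)).hasDerivAt
  have h2 : HasDerivAt (fun t : ℝ => z + t * v) v t := by
    simpa using ((Complex.ofRealCLM.hasDerivAt (x := t)).mul_const v).const_add z
  exact h1.scomp t h2

variable [CompleteSpace E] [CompleteSpace F]

/-- The second derivative of `‖f‖²` along a real line in the direction `v`. -/
theorem deriv_deriv_inner_line {f : ℂ → E} {U : Set ℂ} (hU : IsOpen U)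
    (hf : DifferentiableOn ℂ f U) {z : ℂ} (hz : z ∈ U) (v : ℂ) :
    deriv (deriv fun t : ℝ => ⟪f (z + t * v), f (z + t * v)⟫_ℂ) 0 =
      ⟪f z, v • v • deriv (deriv f) z⟫_ℂ + ⟪v • deriv f z, v • deriv f z⟫_ℂ +
        (⟪v • deriv f z, v • deriv f z⟫_ℂ + ⟪v • v • deriv (deriv f) z, f z⟫_ℂ) := by
  have hV : ∀ᶠ t : ℝ in nhds 0, z + t * v ∈ U := by
    have hc : ContinuousAt (fun t : ℝ => z + t * v) 0 := by fun_prop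
    exact hc.eventually_mem (hU.mem_nhds (by simpa using hz))
  have h1 : (deriv fun t : ℝ => ⟪f (z + t * v), f (z + t * v)⟫_ℂ) =ᶠ[nhds 0]
      fun t : ℝ => ⟪f (z + t * v), v • deriv f (z + t * v)⟫_ℂ +
        ⟪v • deriv f (z + t * v), f (z + t * v)⟫_ℂ := by
    filter_upwards [hV] with t ht
    exact ((hasDerivAt_line hU hf ht).inner ℂ (hasDerivAt_line hU hf ht)).deriv
  rw [h1.deriv_eq]
  have h0 : z + (0 : ℝ) * v ∈ U := by simpa using hz
  have h2 := hasDerivAt_line hU hf h0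
  have h3 : HasDerivAt (fun t : ℝ => v • deriv f (z + t * v))
      (v • v • deriv (deriv f) (z + (0 : ℝ) * v)) 0 :=
    (hasDerivAt_line hU (hf.deriv hU) h0).const_smul v
  have h4 := ((h2.inner ℂ h3).add (h3.inner ℂ h2)).deriv
  simp only [Complex.ofReal_zero, zero_mul, add_zero] at h4
  exact h4

/-- The Laplacian of `‖f‖²` is `4 ‖f'‖²`: in the sum over the directions `1` and `i`, the terms with
`f''` cancel. -/
theorem inner_self_laplacian {f : ℂ → E} {U : Set ℂ} (hU : IsOpen U)
    (hf : DifferentiableOn ℂ f U) {z : ℂ} (hz : z ∈ U) :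
    deriv (deriv fun t : ℝ => ⟪f (z + t * 1), f (z + t * 1)⟫_ℂ) 0 +
        deriv (deriv fun t : ℝ => ⟪f (z + t * Complex.I), f (z + t * Complex.I)⟫_ℂ) 0 =
      4 * (‖deriv f z‖ : ℂ) ^ 2 := by
  rw [deriv_deriv_inner_line hU hf hz, deriv_deriv_inner_line hU hf hz]
  simp only [inner_smul_left, inner_smul_right, one_smul, Complex.conj_I,
    inner_self_eq_norm_sq_to_K]
  simp only [norm_smul, Complex.norm_I, one_mul, Complex.coe_algebraMap]
  linear_combination (⟪f z, deriv (deriv f) z⟫_ℂ + ⟪deriv (deriv f) z, f z⟫_ℂ) * Complex.I_sq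

/-- Holomorphic maps whose norms agree have derivatives whose norms agree, since
`‖f'‖²` is determined by the Laplacian of `‖f‖²`. -/
theorem norm_deriv_eq {f : ℂ → E} {g : ℂ → F} {U : Set ℂ} (hU : IsOpen U)
    (hf : DifferentiableOn ℂ f U) (hg : DifferentiableOn ℂ g U) (h : ∀ z ∈ U, ‖f z‖ = ‖g z‖)
    {z : ℂ} (hz : z ∈ U) : ‖deriv f z‖ = ‖deriv g z‖ := by
  have h1 : ∀ v : ℂ, deriv (deriv fun t : ℝ => ⟪f (z + t * v), f (z + t * v)⟫_ℂ) 0 =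
      deriv (deriv fun t : ℝ => ⟪g (z + t * v), g (z + t * v)⟫_ℂ) 0 := by
    intro v
    have hV : ∀ᶠ t : ℝ in nhds 0, z + t * v ∈ U := by
      have hc : ContinuousAt (fun t : ℝ => z + t * v) 0 := by fun_prop
      exact hc.eventually_mem (hU.mem_nhds (by simpa using hz))
    have : (fun t : ℝ => ⟪f (z + t * v), f (z + t * v)⟫_ℂ) =ᶠ[nhds 0]
        fun t : ℝ => ⟪g (z + t * v), g (z + t * v)⟫_ℂ := by
      filter_upwards [hV] with t ht
      rw [inner_self_eq_norm_sq_to_K, inner_self_eq_norm_sq_to_K, h _ ht]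
    exact this.deriv.deriv_eq
  have h2 := inner_self_laplacian hU hf hz
  rw [h1, h1, inner_self_laplacian hU hg hz] at h2
  have h3 : (‖deriv f z‖ : ℂ) ^ 2 = (‖deriv g z‖ : ℂ) ^ 2 := by linear_combination -h2 / 4
  have h4 : ‖deriv f z‖ ^ 2 = ‖deriv g z‖ ^ 2 := by exact_mod_cast h3
  exact (pow_left_inj₀ (norm_nonneg _) (norm_nonneg _) two_ne_zero).1 h4

theorem hasDerivAt_sum_pow {G : Type*} [NormedAddCommGroup G] [NormedSpace ℂ G] (D : ℕ) (c : ℕ → G)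
    (z : ℂ) : HasDerivAt (fun z : ℂ => ∑ i ∈ Finset.range (D + 1), z ^ i • c i)
      (∑ i ∈ Finset.range D, z ^ i • ((i + 1 : ℂ) • c (i + 1))) z := by
  have h1 := HasDerivAt.fun_sum (u := Finset.range (D + 1)) (x := z)
    (A := fun i z => z ^ i • c i) (A' := fun i => ((i : ℂ) * z ^ (i - 1)) • c i)
    fun i _ => (hasDerivAt_pow i z).smul_const (c i)
  convert h1 using 1
  rw [Finset.sum_range_succ']
  simp [smul_smul, mul_comm]

/-- If a holomorphic map on a disc has the norm of a polynomial map of degree less than `D`, then it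
is itself such a map. -/
theorem exists_poly_of_norm_eq (D : ℕ) {r : ℝ} {f : ℂ → E} {g : ℂ → F} {b : ℕ → F}
    (hf : DifferentiableOn ℂ f (Metric.ball 0 r))
    (hg : ∀ z ∈ Metric.ball 0 r, g z = ∑ i ∈ Finset.range D, z ^ i • b i)
    (h : ∀ z ∈ Metric.ball 0 r, ‖f z‖ = ‖g z‖) :
    ∃ a : ℕ → E, ∀ z ∈ Metric.ball 0 r, f z = ∑ i ∈ Finset.range D, z ^ i • a i := by
  induction D generalizing f g b with
  | zero =>
    refine ⟨0, fun z hz => ?_⟩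
    have := h z hz
    rw [hg z hz] at this
    simpa using this
  | succ D ih =>
    have hgd : ∀ z ∈ Metric.ball (0 : ℂ) r, HasDerivAt g
        (∑ i ∈ Finset.range D, z ^ i • ((i + 1 : ℂ) • b (i + 1))) z := fun z hz =>
      (hasDerivAt_sum_pow D b z).congr_of_eventuallyEq
        (Filter.eventually_of_mem (Metric.isOpen_ball.mem_nhds hz) hg)
    obtain ⟨a, ha⟩ := ih (f := deriv f) (g := deriv g) (b := fun i => (i + 1 : ℂ) • b (i + 1))
      (hf.deriv Metric.isOpen_ball) (fun z hz => (hgd z hz).deriv)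
      fun z hz => norm_deriv_eq Metric.isOpen_ball hf
        (fun z hz => (hgd z hz).differentiableAt.differentiableWithinAt) h hz
    set a' : ℕ → E := fun i => if i = 0 then f 0 else (i : ℂ)⁻¹ • a (i - 1) with ha'
    refine ⟨a', fun z hz => ?_⟩
    have h0 : (0 : ℂ) ∈ Metric.ball (0 : ℂ) r :=
      Metric.mem_ball_self (Metric.pos_of_mem_ball hz)
    have hd : ∀ z ∈ Metric.ball (0 : ℂ) r, HasDerivAt
        (fun z => f z - ∑ i ∈ Finset.range (D + 1), z ^ i • a' i) 0 z := by
      intro z hz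
      have h1 := ((hf z hz).differentiableAt (Metric.isOpen_ball.mem_nhds hz)).hasDerivAt.fun_sub
        (hasDerivAt_sum_pow D a' z)
      convert h1 using 1
      rw [ha z hz, eq_comm, sub_eq_zero]
      refine Finset.sum_congr rfl fun i _ => ?_
      have : (i + 1 : ℂ) ≠ 0 := by exact_mod_cast Nat.succ_ne_zero i
      simp [ha', smul_smul, this]
    have h2 := (convex_ball (0 : ℂ) r).is_const_of_fderivWithin_eq_zero (𝕜 := ℂ)
      (f := fun z => f z - ∑ i ∈ Finset.range (D + 1), z ^ i • a' i)
      (fun z hz => (hd z hz).differentiableAt.differentiableWithinAt)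
      (fun z hz => by
        rw [fderivWithin_of_isOpen Metric.isOpen_ball hz]
        ext
        simp [(hd z hz).deriv]) hz h0
    have h3 : ∑ i ∈ Finset.range (D + 1), (0 : ℂ) ^ i • a' i = f 0 := by
      rw [Finset.sum_range_succ']
      simp [ha']
    simp only [h3, sub_self] at h2
    exact sub_eq_zero.1 h2

end Norms

end BallMaps

/-! ### Maps with the norm of a monomial map are polynomial -/

namespace BallMaps

/-- A function that is polynomial of bounded degree in each variable separately is polynomial, by
Lagrange interpolation in one variable after the other. -/
theorem exists_mvPolynomial_of_separately {σ : Type*} [Fintype σ] [DecidableEq σ] {A : Set ℂ}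
    (hA : A.Infinite) (D : ℕ) {h : (σ → ℂ) → ℂ}
    (hsep : ∀ x : σ → ℂ, (∀ i, x i ∈ A) → ∀ i, ∃ a : ℕ → ℂ, ∀ u ∈ A,
      h (Function.update x i u) = ∑ m ∈ Finset.range D, u ^ m * a m) :
    ∃ P : MvPolynomial σ ℂ, ∀ x : σ → ℂ, (∀ i, x i ∈ A) → h x = MvPolynomial.eval x P := by
  set v : ℕ → ℂ := fun m => (hA.natEmbedding A m : ℂ) with hv
  have hvA : ∀ m, v m ∈ A := fun m => (hA.natEmbedding A m).2
  have hvinj : Function.Injective v := Subtype.val_injective.comp (hA.natEmbedding A).injective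
  have hlag : ∀ x : σ → ℂ, (∀ i, x i ∈ A) → ∀ i, ∀ u ∈ A, h (Function.update x i u) =
      ∑ m ∈ Finset.range D, h (Function.update x i (v m)) *
        (Lagrange.basis (Finset.range D) v m).eval u := by
    intro x hx i u hu
    obtain ⟨a, ha⟩ := hsep x hx i
    set f : Polynomial ℂ := ∑ m ∈ Finset.range D, Polynomial.monomial m (a m) with hf
    have hfe : ∀ u ∈ A, f.eval u = h (Function.update x i u) := fun u hu => by
      rw [ha u hu, hf, Polynomial.eval_finsetSum]
      exact Finset.sum_congr rfl fun m _ => by rw [Polynomial.eval_monomial, mul_comm]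
    have hfd : f.degree < (Finset.range D).card := by
      rw [Finset.card_range, ← Polynomial.mem_degreeLT]
      refine Submodule.sum_mem _ fun m hm => Polynomial.mem_degreeLT.2 ?_
      exact (Polynomial.degree_monomial_le _ _).trans_lt (by exact_mod_cast Finset.mem_range.1 hm)
    have hfi := Lagrange.eq_interpolate_of_eval_eq
      (fun m => h (Function.update x i (v m))) (hvinj.injOn) hfd fun m _ => hfe _ (hvA m)
    rw [← hfe u hu]
    conv_lhs => rw [hfi]
    rw [Lagrange.interpolate_apply, Polynomial.eval_finsetSum]
    simp
  have key : ∀ T : Finset σ, ∀ x : σ → ℂ, (∀ i, x i ∈ A) → ∃ P : MvPolynomial σ ℂ,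
      ∀ y : σ → ℂ, (∀ i, y i ∈ A) → (∀ i ∉ T, y i = x i) → h y = MvPolynomial.eval y P := by
    intro T
    induction T using Finset.induction_on with
    | empty =>
      exact fun x _ => ⟨MvPolynomial.C (h x), fun y _ hyx => by
        rw [MvPolynomial.eval_C, funext fun i => hyx i (by simp)]⟩
    | insert i T hi ih =>
      intro x hx
      have hxm : ∀ m, ∀ j, Function.update x i (v m) j ∈ A := fun m j => by
        by_cases hj : j = i
        · subst hj; simpa using hvA m
        · simpa [hj] using hx j
      choose P hP using fun m => ih (Function.update x i (v m)) (hxm m)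
      refine ⟨∑ m ∈ Finset.range D,
        MvPolynomial.aeval (fun r => if r = i then MvPolynomial.C (v m) else MvPolynomial.X r)
          (P m) * Polynomial.aeval (MvPolynomial.X i) (Lagrange.basis (Finset.range D) v m),
        fun y hy hyx => ?_⟩
      have h1 := hlag y hy i (y i) (hy i)
      rw [Function.update_eq_self] at h1
      rw [h1, map_sum]
      refine Finset.sum_congr rfl fun m _ => ?_
      rw [map_mul]
      congr 1
      · rw [hP m (Function.update y i (v m))]
        · have h2 : (MvPolynomial.aeval (MvPolynomial.eval y ∘ fun r =>
              if r = i then MvPolynomial.C (v m) else MvPolynomial.X r) (P m) : ℂ) =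
              MvPolynomial.eval y (MvPolynomial.aeval (fun r =>
                if r = i then MvPolynomial.C (v m) else MvPolynomial.X r) (P m)) := by
            rw [MvPolynomial.aeval_def, MvPolynomial.aeval_def, MvPolynomial.eval₂_comp_left]
            congr 1
            ext u
            simp
          rw [← h2, MvPolynomial.aeval_eq_eval]
          congr 2
          funext r
          by_cases hr : r = i
          · subst hr; simp
          · simp [hr]
        · intro j
          by_cases hj : j = i
          · subst hj; simpa using hvA m
          · simpa [hj] using hy j
        · intro j hj
          by_cases hji : j = i
          · subst hji; simp
          · simpa [hji] using hyx j (by simp [hji, hj])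
      · rw [Polynomial.aeval_def, Polynomial.hom_eval₂, MvPolynomial.eval_X]
        have : (MvPolynomial.eval y).comp (algebraMap ℂ (MvPolynomial σ ℂ)) = RingHom.id ℂ := by
          ext u
          simp
        rw [this]
        rfl
  by_cases hne : ∃ x : σ → ℂ, ∀ i, x i ∈ A
  · obtain ⟨x, hx⟩ := hne
    obtain ⟨P, hP⟩ := key Finset.univ x hx
    exact ⟨P, fun y hy => hP y hy (by simp)⟩
  · exact ⟨0, fun x hx => absurd ⟨x, hx⟩ hne⟩

theorem _root_.MvPolynomial.IsHomogeneous.eval_mul_left {σ R : Type*} [CommSemiring R]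
    {φ : MvPolynomial σ R} {m : ℕ} (hφ : φ.IsHomogeneous m) (u : R) (z : σ → R) :
    MvPolynomial.eval (fun j => u * z j) φ = u ^ m * MvPolynomial.eval z φ := by
  rw [MvPolynomial.eval_eq, MvPolynomial.eval_eq, Finset.mul_sum]
  refine Finset.sum_congr rfl fun α hα => ?_
  have h := hφ.degree_eq_sum_deg_support hα
  simp only [mul_pow, Finset.prod_mul_distrib, Finset.prod_pow_eq_pow_sum]
  rw [h]
  ring

theorem toLp_mem_B {n : ℕ} {x : Fin n → ℂ} (hx : ∀ i, x i ∈ Metric.ball (0 : ℂ) (1 / (n + 1))) :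
    (WithLp.toLp 2 x : Cn n) ∈ B n := by
  rw [mem_ball_zero_iff, EuclideanSpace.norm_eq, Real.sqrt_lt' one_pos]
  have h0 : (0 : ℝ) < n + 1 := by positivity
  have h1 : ∀ i, ‖x i‖ ^ 2 ≤ (1 / (n + 1 : ℝ)) ^ 2 := fun i =>
    pow_le_pow_left₀ (norm_nonneg _) (mem_ball_zero_iff.1 (hx i)).le 2
  calc ∑ i, ‖x i‖ ^ 2 ≤ ∑ _i : Fin n, (1 / (n + 1 : ℝ)) ^ 2 := Finset.sum_le_sum fun i _ => h1 i
    _ = n / (n + 1 : ℝ) ^ 2 := by simp; ring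
    _ < 1 ^ 2 := by
      rw [div_lt_iff₀ (by positivity)]
      nlinarith [(Nat.cast_nonneg n : (0 : ℝ) ≤ n)]

/-- A holomorphic map on the ball whose norm is that of a monomial map of degree at most `D` is
polynomial, of degree at most `D`. -/
theorem exists_hasDegree_le {n N M D : ℕ} {f : Cn n → Cn M} (hf : DifferentiableOn ℂ f (B n))
    {g : Cn n → Cn N} {α : Fin N → Fin n → ℕ} {c : Fin N → ℂ}
    (hg : ∀ i, ∀ z ∈ B n, g z i = c i * ∏ j, z j ^ α i j) (hfg : NormEquivalent f g)
    (hD : ∀ i, c i ≠ 0 → ∑ j, α i j ≤ D) : ∃ d, HasDegree f d ∧ d ≤ D := by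
  have hnorm : ∀ z ∈ B n, ‖f z‖ = ‖g z‖ := fun z hz =>
    (pow_left_inj₀ (norm_nonneg _) (norm_nonneg _) two_ne_zero).1 (hfg z hz)
  -- restriction to the lines parallel to an axis
  have hslice : ∀ x : Fin n → ℂ, (∀ i, x i ∈ Metric.ball (0 : ℂ) (1 / (n + 1))) → ∀ i,
      ∃ a : ℕ → Cn M, ∀ u ∈ Metric.ball (0 : ℂ) (1 / (n + 1)),
        f (WithLp.toLp 2 (Function.update x i u)) =
          ∑ m ∈ Finset.range (∑ l, ∑ j, α l j + 1), u ^ m • a m := by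
    intro x hx i
    have hmem : ∀ u ∈ Metric.ball (0 : ℂ) (1 / (n + 1)),
        (WithLp.toLp 2 (Function.update x i u) : Cn n) ∈ B n := fun u hu =>
      toLp_mem_B fun j => by
        by_cases hj : j = i
        · subst hj; simpa using hu
        · simpa [hj] using hx j
    refine exists_poly_of_norm_eq _ (g := fun u => g (WithLp.toLp 2 (Function.update x i u)))
      (b := fun m => WithLp.toLp 2 fun l =>
        if α l i = m then c l * ∏ j ∈ Finset.univ.erase i, x j ^ α l j else 0)
      ?_ (fun u hu => ?_) fun u hu => hnorm _ (hmem u hu)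
    · refine hf.comp (Differentiable.differentiableOn ?_) hmem
      rw [differentiable_euclidean]
      intro j
      by_cases hj : j = i
      · subst hj; simp
      · simp [hj]
    · ext l
      rw [hg l _ (hmem u hu)]
      simp only [WithLp.ofLp_sum, WithLp.ofLp_smul, Finset.sum_apply, Pi.smul_apply,
        smul_eq_mul, mul_ite, mul_zero, Finset.sum_ite_eq, Finset.mem_range]
      rw [if_pos]
      · rw [← Finset.mul_prod_erase _ _ (Finset.mem_univ i), Function.update_self,
          Finset.prod_congr rfl fun j hj => by
            rw [Function.update_of_ne (Finset.ne_of_mem_erase hj)]]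
        ring
      · have h1 : α l i ≤ ∑ j, α l j := Finset.single_le_sum (fun _ _ => Nat.zero_le _)
          (Finset.mem_univ i)
        have h2 : ∑ j, α l j ≤ ∑ l, ∑ j, α l j :=
          Finset.single_le_sum (f := fun l => ∑ j, α l j) (fun _ _ => Nat.zero_le _)
            (Finset.mem_univ l)
        omega
  -- restriction to the lines through the origin
  have hline : ∀ z ∈ B n, ∃ R > 1, ∃ a : ℕ → Cn M, ∀ u ∈ Metric.ball (0 : ℂ) R,
      f (u • z) = ∑ m ∈ Finset.range (D + 1), u ^ m • a m := by
    intro z hz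
    have hz1 : ‖z‖ < 1 := mem_ball_zero_iff.1 hz
    have hz0 := norm_nonneg z
    have hmem : ∀ u ∈ Metric.ball (0 : ℂ) (2 / (1 + ‖z‖)), u • z ∈ B n := fun u hu => by
      rw [mem_ball_zero_iff] at hu ⊢
      rw [lt_div_iff₀ (by positivity)] at hu
      rw [norm_smul]
      nlinarith [norm_nonneg u]
    refine ⟨2 / (1 + ‖z‖), by rw [gt_iff_lt, lt_div_iff₀ (by positivity)]; linarith, ?_⟩
    refine exists_poly_of_norm_eq _ (g := fun u => g (u • z))
      (b := fun m => WithLp.toLp 2 fun l =>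
        if ∑ j, α l j = m then c l * ∏ j, z j ^ α l j else 0)
      ?_ (fun u hu => ?_) fun u hu => hnorm _ (hmem u hu)
    · exact hf.comp (by fun_prop) hmem
    · ext l
      rw [hg l _ (hmem u hu)]
      simp only [WithLp.ofLp_sum, WithLp.ofLp_smul, Finset.sum_apply, Pi.smul_apply,
        smul_eq_mul, mul_ite, mul_zero, Finset.sum_ite_eq, Finset.mem_range]
      by_cases hl : c l = 0
      · simp [hl]
      · rw [if_pos (by have := hD l hl; omega)]
        simp only [mul_pow, Finset.prod_mul_distrib,
          Finset.prod_pow_eq_pow_sum]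
        ring
  have hA : (Metric.ball (0 : ℂ) (1 / (n + 1))).Infinite :=
    infinite_of_mem_nhds 0 (Metric.ball_mem_nhds _ (by positivity))
  have hpoly : ∀ l : Fin M, ∃ P : MvPolynomial (Fin n) ℂ, ∀ x : Fin n → ℂ,
      (∀ i, x i ∈ Metric.ball (0 : ℂ) (1 / (n + 1))) →
        f (WithLp.toLp 2 x) l = MvPolynomial.eval x P := fun l =>
    exists_mvPolynomial_of_separately hA (∑ l, ∑ j, α l j + 1) (h := fun x => f (WithLp.toLp 2 x) l) fun x hx i => by
      obtain ⟨a, ha⟩ := hslice x hx i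
      refine ⟨fun m => a m l, fun u hu => ?_⟩
      simp [ha u hu]
  choose P hP using hpoly
  set Q : Fin M → MvPolynomial (Fin n) ℂ := fun l =>
    ∑ m ∈ Finset.range (D + 1), MvPolynomial.homogeneousComponent m (P l) with hQ
  refine ⟨_, ⟨Q, fun z hz l => ?_, rfl⟩, Finset.sup_le fun l _ => ?_⟩
  · obtain ⟨R, hR, a, ha⟩ := hline z hz
    -- along the line through `z`, two polynomials in one variable agree near `0`
    set p₁ : Polynomial ℂ := ∑ m ∈ Finset.range (D + 1), Polynomial.monomial m (a m l) with hp₁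
    set p₂ : Polynomial ℂ := ∑ m ∈ Finset.range ((P l).totalDegree + 1), Polynomial.monomial m
      (MvPolynomial.eval (fun j => z j) (MvPolynomial.homogeneousComponent m (P l))) with hp₂
    have hz1 : ‖z‖ < 1 := mem_ball_zero_iff.1 hz
    have heq : p₁ = p₂ := by
      refine Polynomial.eq_of_infinite_eval_eq _ _ (hA.mono fun u hu => ?_)
      have hu1 : ‖u‖ < 1 / (n + 1) := mem_ball_zero_iff.1 hu
      have hu2 : u ∈ Metric.ball (0 : ℂ) R := by
        rw [mem_ball_zero_iff]
        have : 1 / (n + 1 : ℝ) ≤ 1 := by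
          rw [div_le_one (by positivity)]
          linarith [(Nat.cast_nonneg n : (0 : ℝ) ≤ n)]
        linarith
      have h1 := congrArg (fun w : Cn M => w l) (ha u hu2)
      have h2 := hP l (fun j => u * z j) fun j => by
        rw [mem_ball_zero_iff, norm_mul]
        have := PiLp.norm_apply_le z j
        nlinarith [norm_nonneg u, norm_nonneg (z j)]
      have h3 : (WithLp.toLp 2 (fun j => u * z j) : Cn n) = u • z := by ext j; simp
      rw [h3] at h2
      have h4 : p₁.eval u = f (u • z) l := by
        rw [h1, hp₁, Polynomial.eval_finsetSum]
        simp [mul_comm]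
      have h5 : p₂.eval u = f (u • z) l := by
        rw [h2, hp₂, Polynomial.eval_finsetSum]
        conv_rhs => rw [← MvPolynomial.sum_homogeneousComponent (P l)]
        rw [map_sum]
        refine Finset.sum_congr rfl fun m _ => ?_
        rw [Polynomial.eval_monomial]
        rw [(MvPolynomial.homogeneousComponent_isHomogeneous m (P l)).eval_mul_left, mul_comm]
      exact h4.trans h5.symm
    have hcoef : ∀ m ∈ Finset.range (D + 1), a m l = MvPolynomial.eval (fun j => z j)
        (MvPolynomial.homogeneousComponent m (P l)) := by
      intro m hm
      have h1 := congrArg (fun p => Polynomial.coeff p m) heq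
      simp only [hp₁, hp₂, Polynomial.finsetSum_coeff, Polynomial.coeff_monomial,
        Finset.sum_ite_eq', if_pos hm] at h1
      rw [h1]
      split_ifs with h2
      · rfl
      · rw [MvPolynomial.homogeneousComponent_eq_zero _ _ (by simpa using h2), map_zero]
    have h1 := congrArg (fun w : Cn M => w l)
      (ha 1 (by rw [mem_ball_zero_iff, norm_one]; exact hR))
    simp only [one_smul, one_pow] at h1
    rw [h1, hQ, map_sum]
    simp only [WithLp.ofLp_sum, Finset.sum_apply]
    exact Finset.sum_congr rfl hcoef
  · refine MvPolynomial.totalDegree_finsetSum_le fun m hm => ?_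
    exact (MvPolynomial.homogeneousComponent_isHomogeneous m (P l)).totalDegree_le.trans
      (by simpa [Nat.lt_succ_iff] using hm)

end BallMaps

/-! ### Squared norms as polynomials -/

namespace BallMaps

open MvPolynomial

theorem isCompact_norm_le (n : ℕ) {r : ℝ} (hr : r < 1) :
    IsCompact {w : B n | ‖(w : Cn n)‖ ≤ r} := by
  have h : Subtype.val '' {w : B n | ‖(w : Cn n)‖ ≤ r} = Metric.closedBall (0 : Cn n) r := by
    ext w
    rw [mem_closedBall_zero_iff]
    exact ⟨fun ⟨v, hv, hvw⟩ => hvw ▸ hv,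
      fun hw => ⟨⟨w, mem_ball_zero_iff.2 (hw.trans_lt hr)⟩, hw, rfl⟩⟩
  rw [Topology.IsEmbedding.subtypeVal.isCompact_iff, h]
  exact isCompact_closedBall _ _

theorem IsProperHolomorphic.exists_norm_lt {n N : ℕ} {f : Cn n → Cn N}
    (hf : IsProperHolomorphic f) {r : ℝ} (hr : r < 1) :
    ∃ ρ < 1, ∀ z ∈ B n, ‖f z‖ ≤ r → ‖z‖ < ρ := by
  have hcomp := isCompact_norm_le N hr
  have hpre := (hf.proper.isCompact_preimage hcomp).image continuous_subtype_val
  obtain ⟨ρ, hρ, hsub⟩ := exists_pos_lt_subset_ball one_pos hpre.isClosed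
    (x := (0 : Cn n)) (by rintro _ ⟨z, -, rfl⟩; exact z.2)
  exact ⟨ρ, hρ.2, fun z hz hfz => mem_ball_zero_iff.1 (hsub ⟨⟨z, hz⟩, hfz, rfl⟩)⟩

theorem isProperHolomorphic_of_exists_norm_lt {n N : ℕ} {f : Cn n → Cn N}
    (hd : DifferentiableOn ℂ f (B n)) (hm : Set.MapsTo f (B n) (B N))
    (h : ∀ r < 1, ∃ ρ < 1, ∀ z ∈ B n, ‖f z‖ ≤ r → ‖z‖ < ρ) : IsProperHolomorphic f := by
  refine ⟨hd, hm, ?_⟩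
  have : LocallyCompactSpace (B N) := Metric.isOpen_ball.locallyCompactSpace
  have hc : Continuous (hm.restrict f (B n) (B N)) := hd.continuousOn.mapsToRestrict hm
  refine isProperMap_iff_isCompact_preimage.2 ⟨hc, fun {K} hK => ?_⟩
  have hK' := hK.image continuous_subtype_val
  obtain ⟨r, hr, hsub⟩ := exists_pos_lt_subset_ball one_pos hK'.isClosed
    (x := (0 : Cn N)) (by rintro _ ⟨z, -, rfl⟩; exact z.2)
  obtain ⟨ρ, hρ, hρz⟩ := h r hr.2
  have hcomp := isCompact_norm_le n hρ
  refine hcomp.of_isClosed_subset (hK.isClosed.preimage hc) fun z hz => ?_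
  exact (hρz z z.2 (mem_ball_zero_iff.1 (hsub ⟨_, hz, rfl⟩)).le).le

/-- The squared norm of `f` is the polynomial `p` in the variables `|z₁|², …, |zₙ|²`. -/
def HasNormPoly {n N : ℕ} (f : Cn n → Cn N) (p : MvPolynomial (Fin n) ℝ) : Prop :=
  ∀ z ∈ B n, ‖f z‖ ^ 2 = eval (fun j => ‖z j‖ ^ 2) p

theorem eq_of_eval_norm_sq {n : ℕ} {p q : MvPolynomial (Fin n) ℝ}
    (h : ∀ z ∈ B n, eval (fun j => ‖z j‖ ^ 2) p = eval (fun j => ‖z j‖ ^ 2) q) : p = q := by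
  have h0 : (0 : ℝ) < 1 / (n + 1) := by positivity
  refine funext_set (fun _ => Set.Ico 0 ((1 / (n + 1 : ℝ)) ^ 2))
    (fun _ => Set.Ico_infinite (by positivity)) fun x hx => ?_
  have hx' : ∀ i, 0 ≤ x i ∧ x i < (1 / (n + 1 : ℝ)) ^ 2 := fun i => hx i (Set.mem_univ i)
  have h1 := h (WithLp.toLp 2 fun i => ((Real.sqrt (x i) : ℝ) : ℂ)) (toLp_mem_B fun i => by
    rw [mem_ball_zero_iff, Complex.norm_real, Real.norm_of_nonneg (Real.sqrt_nonneg _),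
      Real.sqrt_lt' h0]
    exact (hx' i).2)
  have h2 : (fun i => ‖((Real.sqrt (x i) : ℝ) : ℂ)‖ ^ 2) = x := by
    funext i
    rw [Complex.norm_real, Real.norm_of_nonneg (Real.sqrt_nonneg _), Real.sq_sqrt (hx' i).1]
  simpa only [h2] using h1

/-- The squared norm of a proper map tends to `1` at the unit sphere. -/
theorem HasNormPoly.eval_simplex {n N : ℕ} {f : Cn n → Cn N} {p : MvPolynomial (Fin n) ℝ}
    (hp : HasNormPoly f p) (hf : IsProperHolomorphic f) {x : Fin n → ℝ} (hx : ∀ i, 0 ≤ x i)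
    (hx1 : ∑ i, x i = 1) : eval x p = 1 := by
  set φ : ℝ → ℝ := fun s => eval (fun j => s ^ 2 * x j) p with hφ
  have hφc : Continuous φ := (MvPolynomial.continuous_eval p).comp (by fun_prop)
  set z : ℝ → Cn n := fun s => WithLp.toLp 2 fun i => ((s * Real.sqrt (x i) : ℝ) : ℂ) with hz
  have hzs : ∀ s i, ‖z s i‖ ^ 2 = s ^ 2 * x i := fun s i => by
    simp only [hz, Complex.norm_real, Real.norm_eq_abs, sq_abs, mul_pow, Real.sq_sqrt (hx i)]
  have hzn : ∀ s, 0 ≤ s → ‖z s‖ = s := fun s hs => by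
    rw [EuclideanSpace.norm_eq, Finset.sum_congr rfl fun i _ => hzs s i, ← Finset.mul_sum, hx1,
      mul_one, Real.sqrt_sq hs]
  have hfz : ∀ s, 0 ≤ s → s < 1 → ‖f (z s)‖ ^ 2 = φ s := fun s hs hs1 => by
    rw [hp _ (mem_ball_zero_iff.2 ((hzn s hs).trans_lt hs1)), funext (hzs s)]
  have hφ1 : φ 1 = eval x p := by simp [hφ]
  have hev : ∀ᶠ s : ℝ in nhdsWithin 1 (Set.Iio 1), 0 ≤ s ∧ s < 1 :=
    Filter.Eventually.and (mem_nhdsWithin_of_mem_nhds (Ici_mem_nhds one_pos)) self_mem_nhdsWithin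
  have hlim : Filter.Tendsto φ (nhdsWithin 1 (Set.Iio 1)) (nhds (φ 1)) :=
    hφc.continuousAt.continuousWithinAt
  rw [← hφ1]
  refine le_antisymm (le_of_tendsto hlim ?_) (le_of_not_gt fun hlt => ?_)
  · filter_upwards [hev] with s hs
    rw [← hfz s hs.1 hs.2]
    have := mem_ball_zero_iff.1 (hf.mapsTo (mem_ball_zero_iff.2 ((hzn s hs.1).trans_lt hs.2)))
    exact pow_le_one₀ (norm_nonneg _) this.le
  · obtain ⟨r, hr1, hr⟩ := exists_between (max_lt hlt one_pos)
    obtain ⟨ρ, hρ, hρz⟩ := hf.exists_norm_lt (r := Real.sqrt r) (by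
      rw [Real.sqrt_lt' one_pos]; simpa using hr)
    have h1 : ∀ᶠ s in nhdsWithin 1 (Set.Iio 1), φ s < r :=
      hlim.eventually_lt_const ((le_max_left _ _).trans_lt hr1)
    have h2 : ∀ᶠ s : ℝ in nhdsWithin 1 (Set.Iio 1), ρ < s :=
      mem_nhdsWithin_of_mem_nhds (Ioi_mem_nhds hρ)
    obtain ⟨s, ⟨⟨hs0, hs1⟩, hs2⟩, hs3⟩ := ((hev.and h1).and h2).exists
    have h3 := hρz (z s) (mem_ball_zero_iff.2 ((hzn s hs0).trans_lt hs1))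
      (Real.le_sqrt_of_sq_le ((hfz s hs0 hs1).trans_lt hs2).le)
    rw [hzn s hs0] at h3
    linarith

theorem HasNormPoly.one_le_totalDegree {n N : ℕ} (hn : 0 < n) {f : Cn n → Cn N}
    {p : MvPolynomial (Fin n) ℝ} (hp : HasNormPoly f p) (hf : IsProperHolomorphic f) :
    1 ≤ p.totalDegree := by
  by_contra! h
  have h1 := (totalDegree_eq_zero_iff_eq_C (p := p)).1 (by omega)
  have h2 := hp.eval_simplex hf (x := Pi.single ⟨0, hn⟩ 1)
    (fun i => by by_cases hi : i = ⟨0, hn⟩ <;> simp [hi]) (by simp)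
  have h0 : (0 : Cn n) ∈ B n := by simp
  have h3 := hp 0 h0
  rw [h1, eval_C] at h2 h3
  rw [h2] at h3
  have h4 := mem_ball_zero_iff.1 (hf.mapsTo h0)
  nlinarith [norm_nonneg (f 0)]

/-- The polynomial of a monomial map has one term for each monomial that occurs, with positive
coefficient. -/
theorem IsMonomialMap.exists_normPoly {n N : ℕ} {g : Cn n → Cn N} (hg : IsMonomialMap g) :
    ∃ p, HasNormPoly g p ∧ (∀ α, 0 ≤ p.coeff α) ∧ p.support.card ≤ N ∧
      ∀ {M : ℕ} {f : Cn n → Cn M}, DifferentiableOn ℂ f (B n) → NormEquivalent f g →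
        ∃ d, HasDegree f d ∧ d ≤ p.totalDegree := by
  classical
  choose α c hαc using hg
  set β : Fin N → Fin n →₀ ℕ := fun i => Finsupp.equivFunOnFinite.symm (α i) with hβ
  set p : MvPolynomial (Fin n) ℝ := ∑ i, monomial (β i) (‖c i‖ ^ 2) with hp
  have hcoeff : ∀ γ, p.coeff γ = ∑ i, if β i = γ then ‖c i‖ ^ 2 else 0 := fun γ => by
    simp [hp, coeff_sum, coeff_monomial]
  have hnn : ∀ γ i, (0 : ℝ) ≤ if β i = γ then ‖c i‖ ^ 2 else 0 := fun γ i => by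
    split_ifs <;> positivity
  refine ⟨p, fun z hz => ?_, fun γ => ?_, ?_, fun hf hfg => ?_⟩
  · rw [EuclideanSpace.norm_sq_eq, hp, map_sum]
    refine Finset.sum_congr rfl fun i _ => ?_
    rw [hαc i z hz, eval_monomial, Finsupp.prod_fintype _ _ (by simp), norm_mul, norm_prod, mul_pow,
      ← Finset.prod_pow]
    simp [hβ, ← pow_mul, mul_comm]
  · rw [hcoeff]
    exact Finset.sum_nonneg fun i _ => hnn γ i
  · refine (Finset.card_le_card (t := Finset.univ.image β) fun γ hγ => ?_).trans
      (Finset.card_image_le.trans_eq (by simp))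
    by_contra h
    refine mem_support_iff.1 hγ ?_
    rw [hcoeff]
    refine Finset.sum_eq_zero fun i _ => if_neg fun hi => h ?_
    exact Finset.mem_image.2 ⟨i, Finset.mem_univ i, hi⟩
  · refine exists_hasDegree_le hf hαc hfg fun i hi => ?_
    have h1 : β i ∈ p.support := by
      rw [mem_support_iff, hcoeff]
      refine (lt_of_lt_of_le ?_ (Finset.single_le_sum (fun j _ => hnn (β i) j)
        (Finset.mem_univ i))).ne'
      rw [if_pos rfl]
      exact pow_pos (norm_pos_iff.2 hi) 2
    refine le_trans (le_of_eq ?_) (le_totalDegree h1)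
    rw [Finsupp.sum_fintype _ _ (by simp)]
    simp [hβ]

/-! ### Convex families -/

namespace ConvexFamily

variable {n k : ℕ} (F : ConvexFamily n k)

/-- In barycentric coordinates, the squared norms of a convex family are the affine combinations of
those of the generators. -/
theorem R_eq_sum {c : Fin (k + 1) → ℝ} (hc : ∑ j, c j = 1) (z : Cn n) :
    F.R (fun j => c j.castSucc) z = ∑ j, c j * ‖F.gen j z‖ ^ 2 := by
  rw [Fin.sum_univ_castSucc] at hc ⊢
  rw [R, ← hc, add_sub_cancel_left]

theorem mem_of_norm_sq_eq {M : ℕ} {f : Cn n → Cn M} (hf : IsProperHolomorphic f)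
    {c : Fin (k + 1) → ℝ} (hc : ∑ j, c j = 1)
    (h : ∀ z ∈ B n, ‖f z‖ ^ 2 = ∑ j, c j * ‖F.gen j z‖ ^ 2) : F.Mem f :=
  have h' : ∀ z ∈ B n, ‖f z‖ ^ 2 = F.R (fun j => c j.castSucc) z := fun z hz => by
    rw [F.R_eq_sum hc, h z hz]
  ⟨hf, _, ⟨Cn M, inferInstance, inferInstance, inferInstance, f, hf.holomorphic,
    fun z hz => (h' z hz).symm⟩, h'⟩

theorem Mem.exists_coord {F : ConvexFamily n k} {M : ℕ} {f : Cn n → Cn M} (hf : F.Mem f) :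
    ∃ c : Fin (k + 1) → ℝ, ∑ j, c j = 1 ∧
      ∀ z ∈ B n, ‖f z‖ ^ 2 = ∑ j, c j * ‖F.gen j z‖ ^ 2 := by
  obtain ⟨-, t, -, ht⟩ := hf
  have hc : ∑ j, (Fin.snoc t (1 - ∑ j, t j) : Fin (k + 1) → ℝ) j = 1 := by
    simp [Fin.sum_univ_castSucc]
  refine ⟨_, hc, fun z hz => ?_⟩
  rw [ht z hz, ← F.R_eq_sum hc]
  simp

theorem mem_gen (j : Fin (k + 1)) : F.Mem (F.gen j) :=
  F.mem_of_norm_sq_eq (F.proper j) (c := Pi.single j 1) (by simp) fun z _ => by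
    simp [Pi.single_apply]

/-- The barycenter of the generators: their orthogonal sum, rescaled by `1 / √(k + 1)`. -/
noncomputable def barycenter : Cn n → Cn (∑ j, F.targetDim j) := fun z =>
  WithLp.toLp 2 fun i => ((Real.sqrt (1 / (k + 1)) : ℝ) : ℂ) *
    F.gen (finSigmaFinEquiv.symm i).1 z (finSigmaFinEquiv.symm i).2

theorem norm_sq_barycenter (z : Cn n) :
    ‖F.barycenter z‖ ^ 2 = ∑ j, 1 / (k + 1 : ℝ) * ‖F.gen j z‖ ^ 2 := by
  rw [EuclideanSpace.norm_sq_eq, ← finSigmaFinEquiv.sum_comp, Fintype.sum_sigma]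
  refine Finset.sum_congr rfl fun j _ => ?_
  rw [EuclideanSpace.norm_sq_eq, Finset.mul_sum]
  refine Finset.sum_congr rfl fun i _ => ?_
  simp only [barycenter, norm_mul, mul_pow, Complex.norm_real, Real.norm_eq_abs, sq_abs]
  rw [Real.sq_sqrt (by positivity), Equiv.symm_apply_apply]

theorem sum_barycenter_weights (k : ℕ) : ∑ _j : Fin (k + 1), 1 / (k + 1 : ℝ) = 1 := by
  rw [Finset.sum_const, Finset.card_univ, Fintype.card_fin, nsmul_eq_mul]
  push_cast
  field_simp

theorem mem_barycenter : F.Mem F.barycenter := by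
  have hk : (0 : ℝ) < 1 / (k + 1) := by positivity
  refine F.mem_of_norm_sq_eq (isProperHolomorphic_of_exists_norm_lt ?_ (fun z hz => ?_)
    fun r hr => ?_) (sum_barycenter_weights k) fun z _ => F.norm_sq_barycenter z
  · rw [differentiableOn_euclidean]
    intro i
    exact (differentiableOn_euclidean.1 (F.proper _).holomorphic _).const_mul _
  · have h1 : ‖F.barycenter z‖ ^ 2 < 1 := by
      rw [norm_sq_barycenter]
      refine lt_of_lt_of_eq ?_ (sum_barycenter_weights k)
      refine Finset.sum_lt_sum_of_nonempty Finset.univ_nonempty fun j _ => ?_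
      have h2 := mem_ball_zero_iff.1 ((F.proper j).mapsTo hz)
      exact mul_lt_of_lt_one_right hk (pow_lt_one₀ (norm_nonneg _) h2 two_ne_zero)
    rw [mem_ball_zero_iff]
    nlinarith [norm_nonneg (F.barycenter z)]
  · choose ρ hρ hρz using fun j => (F.proper j).exists_norm_lt hr
    refine ⟨Finset.univ.sup' Finset.univ_nonempty ρ, by simpa using hρ, fun z hz hzr => ?_⟩
    obtain ⟨j, hj⟩ : ∃ j, ‖F.gen j z‖ ≤ r := by
      by_contra! h
      have h1 : ∑ _j : Fin (k + 1), 1 / (k + 1 : ℝ) * r ^ 2 < ‖F.barycenter z‖ ^ 2 := by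
        rw [norm_sq_barycenter]
        refine Finset.sum_lt_sum_of_nonempty Finset.univ_nonempty fun j _ => ?_
        have := h j
        have := norm_nonneg (F.barycenter z)
        exact mul_lt_mul_of_pos_left (by gcongr; linarith) hk
      rw [← Finset.sum_mul, sum_barycenter_weights, one_mul] at h1
      exact absurd (pow_le_pow_left₀ (norm_nonneg _) hzr 2) (not_le.2 h1)
    exact (hρz j z hz hj).trans_le (Finset.le_sup' ρ (Finset.mem_univ j))

theorem IsMonomialInto.exists_normPoly {F : ConvexFamily n k} {N : ℕ} (hF : F.IsMonomialInto N)
    {M : ℕ} {f : Cn n → Cn M} (hf : F.Mem f) :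
    ∃ p, HasNormPoly f p ∧ (∀ α, 0 ≤ p.coeff α) ∧ p.support.card ≤ N ∧
      ∃ d, HasDegree f d ∧ d ≤ p.totalDegree := by
  obtain ⟨g, -, hg, hfg⟩ := hF M f hf
  obtain ⟨p, hp, hp0, hpN, hd⟩ := hg.exists_normPoly
  exact ⟨p, fun z hz => (hfg z hz).trans (hp z hz), hp0, hpN, hd hf.1.holomorphic hfg⟩

/-- The bound with the constant `1` in place of `4 / 3`. -/
theorem IsMonomialInto.exists_degree_le {F : ConvexFamily n k} {N m : ℕ}
    (hF : F.IsMonomialInto N) (hn : n = m + 2) {M : ℕ} {f : Cn n → Cn M} (hf : F.Mem f) :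
    ∃ d, HasDegree f d ∧ (2 * m + 1) * d + 3 + 2 * k ≤ 2 * N := by
  choose P hP hP0 _ _ using fun j => hF.exists_normPoly (F.mem_gen j)
  obtain ⟨p, hp, hp0, -, d, hd, hdp⟩ := hF.exists_normPoly hf
  obtain ⟨b, hb, -, hbN, -⟩ := hF.exists_normPoly F.mem_barycenter
  obtain ⟨c, hc, hcf⟩ := hf.exists_coord
  have hpc : p = ∑ j, c j • P j := eq_of_eval_norm_sq fun z hz => by
    rw [← hp z hz, hcf z hz, map_sum]
    exact Finset.sum_congr rfl fun j _ => by rw [smul_eval, hP j z hz]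
  have hbc : b = ∑ j, (1 / (k + 1 : ℝ)) • P j := eq_of_eval_norm_sq fun z hz => by
    rw [← hb z hz, F.norm_sq_barycenter, map_sum]
    exact Finset.sum_congr rfl fun j _ => by rw [smul_eval, hP j z hz]
  have hS : ∀ j, (P j).support ⊆ b.support := fun j α hα => by
    rw [mem_support_iff, hbc, coeff_sum]
    refine (Finset.sum_pos' (fun i _ => ?_) ⟨j, Finset.mem_univ j, ?_⟩).ne'
    · rw [coeff_smul, smul_eq_mul]
      exact mul_nonneg (by positivity) (hP0 i α)
    · rw [coeff_smul, smul_eq_mul]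
      exact mul_pos (by positivity) ((hP0 j α).lt_of_ne' (mem_support_iff.1 hα))
  have hlin : LinearIndependent ℝ P := by
    rw [Fintype.linearIndependent_iff]
    intro a ha
    refine Fintype.linearIndependent_iff.1 F.linearIndependent a (funext fun z => ?_)
    have h1 := congrArg (eval fun j => ‖(z : Cn n) j‖ ^ 2) ha
    rw [map_sum, map_zero] at h1
    rw [Finset.sum_apply, Pi.zero_apply, ← h1]
    exact Finset.sum_congr rfl fun j _ => by
      rw [smul_eval, ← hP j z z.2, Pi.smul_apply, smul_eq_mul]
  have hmain := family_degree_bound (m := m) (by simpa using hn) hlin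
    (fun j x hx hx1 => (hP j).eval_simplex (F.proper j) hx hx1) hS hc
    (fun α => by rw [← hpc]; exact hp0 α)
    (by rw [← hpc]; exact hp.one_le_totalDegree (by omega) hf.1)
  rw [← hpc] at hmain
  refine ⟨d, hd, ?_⟩
  have := Nat.mul_le_mul_left (2 * m + 1) hdp
  omega

end ConvexFamily

end BallMaps

theorem corollary3 (n N k : ℕ) (hn : 2 ≤ n) (F : BallMaps.ConvexFamily n k)
    (hF : F.IsMonomialInto N) (M : ℕ) (f : BallMaps.Cn n → BallMaps.Cn M) (hf : F.Mem f) :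
    ∃ d : ℕ, BallMaps.HasDegree f d ∧
      (d : ℝ) ≤ 4 / 3 * ((2 * ((N : ℝ) - (k : ℝ)) - 3) / (2 * (n : ℝ) - 3)) := by
  obtain ⟨m, rfl⟩ := Nat.exists_eq_add_of_le' hn
  obtain ⟨d, hd, hle⟩ := hF.exists_degree_le rfl hf
  refine ⟨d, hd, ?_⟩
  have h1 : (2 * (m : ℝ) + 1) * d + 3 + 2 * k ≤ 2 * N := by exact_mod_cast hle
  have h2 : (0 : ℝ) < 2 * ((m + 2 : ℕ) : ℝ) - 3 := by
    push_cast
    linarith [(Nat.cast_nonneg m : (0 : ℝ) ≤ m)]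
  have h3 : (d : ℝ) ≤ (2 * ((N : ℝ) - k) - 3) / (2 * ((m + 2 : ℕ) : ℝ) - 3) := by
    rw [le_div_iff₀ h2]
    push_cast
    linarith
  linarith [(Nat.cast_nonneg d : (0 : ℝ) ≤ d)]
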